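/- Let $M$ be a smooth $5$-dimensional manifold (without boundary, Hausdorff, second countable) with a smooth effective action of $\mathrm{SO}(3)$, and let $\alpha$ be an $\mathrm{SO}(3)$-invariant contact form on $M$. For $X\in\mathfrak{so}(3)$ let $X_M(p)=\frac{d}{dt}\big|_{t=0}\exp(tX)\,p$ be the infinitesimal generator, and let $\mu:M\to\mathfrak{so}(3)^*$, $\langle\mu(p),X\rangle=\alpha_p(X_M(p))$, be the moment map. A principal stabilizer is a subgroup $H\le\mathrm{SO}(3)$ which is the stabilizer of some point and a conjugate of which is contained in the stabilizer of every point (if $M$ is connected, such $H$ exists and is unique up to conjugation, by the principal orbit theorem). An orbit is singular if its dimension is smaller than the maximal dimension of an orbit in $M$ (the dimension of the principal orbits). Then: 1. There is an integer $k\ge 1$ such that every principal stabilizer is isomorphic to the finite cyclic group $\mathbb{Z}_k$ (the trivial group for $k=1$). 2. Every singular orbit lies in $\mu^{-1}(0)$. 3. The union of all singular orbits equals $\mu^{-1}(0)$. -/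

import Mathlib

open scoped Manifold ContDiff Topology
open Bundle Filter

noncomputable section

namespace ContactSO3

open Matrix in
/-- The Lie group `SO(3)`. -/
abbrev SO3 : Type := ↥(specialOrthogonalGroup (Fin 3) ℝ)

/-- The space `ℝ^{3 × 3}` of arrays of matrix entries, as a normed space. -/
abbrev Mat3 : Type := Fin 3 → Fin 3 → ℝ

/-- The inclusion of `SO(3)` as a submanifold of `ℝ^{3 × 3}`. -/
def entries (g : SO3) : Mat3 := fun i j => (g : Matrix (Fin 3) (Fin 3) ℝ) i j

/-- The Lie algebra `so(3)` of `SO(3)`: the real skew-symmetric `3 × 3` matrices. -/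
def so3 : Submodule ℝ (Matrix (Fin 3) (Fin 3) ℝ) where
  carrier := {X | X.transpose = -X}
  add_mem' {X Y} hX hY := by
    simp only [Set.mem_ofPred_eq] at hX hY ⊢
    rw [Matrix.transpose_add, hX, hY, neg_add]
  zero_mem' := by simp
  smul_mem' c X hX := by
    simp only [Set.mem_ofPred_eq] at hX ⊢
    rw [Matrix.transpose_smul, hX, smul_neg]

theorem exp_mem_SO3 (X : so3) :
    NormedSpace.exp (X : Matrix (Fin 3) (Fin 3) ℝ) ∈
      Matrix.specialOrthogonalGroup (Fin 3) ℝ := by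
  have key : ∀ Y : Matrix (Fin 3) (Fin 3) ℝ, Y.transpose = -Y →
      NormedSpace.exp Y * (NormedSpace.exp Y).transpose = 1 := by
    intro Y hY
    rw [← Matrix.exp_transpose, hY, ← Matrix.exp_add_of_commute _ _ ((Commute.refl Y).neg_right)]
    simp
  have h2 : NormedSpace.exp (X : Matrix (Fin 3) (Fin 3) ℝ) =
      NormedSpace.exp (((1 / 2 : ℝ) • X : so3) : Matrix (Fin 3) (Fin 3) ℝ) *
        NormedSpace.exp (((1 / 2 : ℝ) • X : so3) : Matrix (Fin 3) (Fin 3) ℝ) := by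
    rw [← Matrix.exp_add_of_commute _ _ rfl, ← Submodule.coe_add, ← add_smul]
    norm_num
  rw [Matrix.mem_specialOrthogonalGroup_iff, Matrix.mem_orthogonalGroup_iff]
  refine ⟨?_, ?_⟩
  · exact key _ X.2
  · have h3 := congrArg Matrix.det (key _ ((1 / 2 : ℝ) • X : so3).2)
    rw [Matrix.det_mul, Matrix.det_transpose, Matrix.det_one] at h3
    rw [h2, Matrix.det_mul, h3]

/-- The exponential map `exp : so(3) → SO(3)`. -/
def expSO3 (X : so3) : SO3 := ⟨NormedSpace.exp (X : Matrix (Fin 3) (Fin 3) ℝ), exp_mem_SO3 X⟩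

section
open scoped Matrix.Norms.Operator

theorem hasDerivAt_entries_expSO3 (X : so3) :
    HasDerivAt (fun t : ℝ => entries (expSO3 (t • X)))
      (fun i j => (X : Matrix (Fin 3) (Fin 3) ℝ) i j) 0 := by
  have hc := hasDerivAt_exp_smul_const (𝕂 := ℝ) (X : Matrix (Fin 3) (Fin 3) ℝ) (0 : ℝ)
  rw [zero_smul, NormedSpace.exp_zero, one_mul] at hc
  exact hc

end

section Action

variable (n : ℕ) (M : Type*) [TopologicalSpace M] [ChartedSpace (EuclideanSpace ℝ (Fin n)) M]
  [MulAction SO3 M]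

/-- The action map `SO(3) × M → M` is smooth: `SO(3)` is a submanifold of `ℝ^{3 × 3}`, so a map on
`SO(3) × M` is smooth iff near each point of `SO(3) × M` it is the restriction of a smooth map
defined on an open subset of `ℝ^{3 × 3} × M`. -/
class SmoothSO3Action : Prop where
  exists_extension : ∀ (g : SO3) (p : M), ∃ U : Set (Mat3 × M), IsOpen U ∧ (entries g, p) ∈ U ∧
    ∃ F : Mat3 × M → M, ContMDiffOn (𝓘(ℝ, Mat3).prod (𝓡 n)) (𝓡 n) ∞ F U ∧
      ∀ (h : SO3) (q : M), (entries h, q) ∈ U → F (entries h, q) = h • q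

end Action

section Generators

variable (n : ℕ) {M : Type*} [TopologicalSpace M] [ChartedSpace (EuclideanSpace ℝ (Fin n)) M]
  [MulAction SO3 M]

/-- The infinitesimal generator `X_M(p) = d/dt|_{t=0} exp(tX) p` of the action. -/
def infGen (X : so3) (p : M) : TangentSpace (𝓡 n) p :=
  (mfderiv 𝓘(ℝ, ℝ) (𝓡 n) (fun t : ℝ => expSO3 (t • X) • p) 0 (1 : ℝ) :)

theorem entries_expSO3_zero_smul (X : so3) :
    entries (expSO3 ((0 : ℝ) • X)) = entries 1 := by
  ext i j
  simp [entries, expSO3]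

/-- Computation of `X_M(p)` through a smooth extension; it shows that `X_M(p)` is linear in `X`. -/
theorem exists_linear_infGen [SmoothSO3Action n M] (p : M) :
    ∃ L : so3 →ₗ[ℝ] TangentSpace (𝓡 n) p, ∀ X : so3, L X = infGen n X p := by
  obtain ⟨U, hU, hmem, F, hF, hFs⟩ := SmoothSO3Action.exists_extension (n := n) (1 : SO3) p
  have hFat : MDifferentiableAt (𝓘(ℝ, Mat3).prod (𝓡 n)) (𝓡 n) F (entries 1, p) :=
    (hF.contMDiffAt (hU.mem_nhds hmem)).mdifferentiableAt (by simp)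
  have hf : MDifferentiableAt 𝓘(ℝ, Mat3) (𝓡 n) (fun A : Mat3 => F (A, p)) (entries 1) := by
    have hpair : MDifferentiableAt 𝓘(ℝ, Mat3) (𝓘(ℝ, Mat3).prod (𝓡 n))
        (fun A : Mat3 => (A, p)) (entries 1) := mdifferentiableAt_id.prodMk mdifferentiableAt_const
    exact MDifferentiableAt.comp (entries 1) hFat hpair
  let D : Mat3 →ₗ[ℝ] EuclideanSpace ℝ (Fin n) := ContinuousLinearMap.toLinearMap
    (mfderiv 𝓘(ℝ, Mat3) (𝓡 n) (fun A : Mat3 => F (A, p)) (entries 1))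
  let incl : so3 →ₗ[ℝ] Mat3 :=
    { toFun := fun X i j => (X : Matrix (Fin 3) (Fin 3) ℝ) i j
      map_add' := fun _ _ => rfl
      map_smul' := fun _ _ => rfl }
  refine ⟨D ∘ₗ incl, fun X => ?_⟩
  have hc := hasDerivAt_entries_expSO3 X
  have hc0 := entries_expSO3_zero_smul X
  have hev : (fun t : ℝ => expSO3 (t • X) • p) =ᶠ[𝓝 0]
      (fun A : Mat3 => F (A, p)) ∘ (fun t : ℝ => entries (expSO3 (t • X))) := by
    have hcont : ContinuousAt (fun t : ℝ => (entries (expSO3 (t • X)), p)) 0 :=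
      hc.continuousAt.prodMk continuousAt_const
    have hin := hcont.preimage_mem_nhds (t := U) (by
      rw [hc0]; exact hU.mem_nhds hmem)
    filter_upwards [hin] with t ht
    exact (hFs (expSO3 (t • X)) p ht).symm
  have hmd := hc.hasFDerivAt.hasMFDerivAt
  have hf' : HasMFDerivAt 𝓘(ℝ, Mat3) (𝓡 n) (fun A : Mat3 => F (A, p))
      (entries (expSO3 ((0 : ℝ) • X)))
      (mfderiv 𝓘(ℝ, Mat3) (𝓡 n) (fun A : Mat3 => F (A, p)) (entries 1)) := by
    rw [hc0]; exact hf.hasMFDerivAt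
  have hcomp := (hf'.comp (0 : ℝ) hmd).congr_of_eventuallyEq hev
  unfold infGen
  rw [hcomp.mfderiv]
  change D (incl X) = D ((1 : ℝ) • incl X)
  rw [one_smul]

variable (M) in
/-- The infinitesimal generators at `p` as a linear map `so(3) → T_pM`. -/
def infGenLinear [SmoothSO3Action n M] (p : M) : so3 →ₗ[ℝ] TangentSpace (𝓡 n) p where
  toFun X := infGen n X p
  map_add' X Y := by
    obtain ⟨L, hL⟩ := exists_linear_infGen n p
    simp only [← hL, map_add]
  map_smul' c X := by
    obtain ⟨L, hL⟩ := exists_linear_infGen n p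
    simp only [← hL, map_smul, RingHom.id_apply]

end Generators
section Forms

variable {n : ℕ} {M : Type*} [TopologicalSpace M] [ChartedSpace (EuclideanSpace ℝ (Fin n)) M]

/-- Smoothness of a `1`-form `α`, as a section of the cotangent bundle. -/
def IsSmoothOneForm [IsManifold (𝓡 n) ∞ M]
    (α : ∀ p : M, TangentSpace (𝓡 n) p →L[ℝ] ℝ) : Prop :=
  ContMDiff (𝓡 n) ((𝓡 n).prod 𝓘(ℝ, EuclideanSpace ℝ (Fin n) →L[ℝ] ℝ)) ∞
    (fun p : M => TotalSpace.mk' (EuclideanSpace ℝ (Fin n) →L[ℝ] ℝ)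
      (E := fun q : M => TangentSpace (𝓡 n) q →L[ℝ] ℝ) p (α p))

/-- The coordinate representation, on an open subset of `ℝⁿ`, of the `1`-form `α` in the preferred
chart `φ` at `p`: the pullback of `α` under `φ⁻¹`. -/
def localForm (α : ∀ p : M, TangentSpace (𝓡 n) p →L[ℝ] ℝ) (p : M) (y : EuclideanSpace ℝ (Fin n)) :
    EuclideanSpace ℝ (Fin n) →L[ℝ] ℝ :=
  (α ((extChartAt (𝓡 n) p).symm y)).comp
    (mfderiv 𝓘(ℝ, EuclideanSpace ℝ (Fin n)) (𝓡 n) (extChartAt (𝓡 n) p).symm y)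

/-- The exterior derivative `dα` at `p`, evaluated on two tangent vectors at `p`; it is computed in
the preferred chart `φ` at `p`, whose derivative at `p` carries tangent vectors to `ℝⁿ`. -/
def dForm (α : ∀ p : M, TangentSpace (𝓡 n) p →L[ℝ] ℝ) (p : M) (v w : TangentSpace (𝓡 n) p) : ℝ :=
  extDeriv
    (fun y => ContinuousAlternatingMap.ofSubsingleton ℝ (EuclideanSpace ℝ (Fin n)) ℝ (0 : Fin 1)
      (localForm α p y))
    (extChartAt (𝓡 n) p p)
    ![mfderiv (𝓡 n) 𝓘(ℝ, EuclideanSpace ℝ (Fin n)) (extChartAt (𝓡 n) p) p v,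
      mfderiv (𝓡 n) 𝓘(ℝ, EuclideanSpace ℝ (Fin n)) (extChartAt (𝓡 n) p) p w]

/-- A contact form: a smooth nowhere vanishing `1`-form `α` such that `dα` is nondegenerate on the
hyperplane `ker α` at every point. In dimension `2m + 1` this says `α ∧ (dα)^m ≠ 0` everywhere. -/
structure IsContactForm [IsManifold (𝓡 n) ∞ M]
    (α : ∀ p : M, TangentSpace (𝓡 n) p →L[ℝ] ℝ) : Prop where
  smooth : IsSmoothOneForm α
  ne_zero : ∀ p : M, α p ≠ 0
  nondegenerate : ∀ (p : M) (v : TangentSpace (𝓡 n) p), α p v = 0 →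
    (∀ w : TangentSpace (𝓡 n) p, α p w = 0 → dForm α p v w = 0) → v = 0

/-- The `1`-form `α` is invariant under the action: `g^* α = α` for all `g`. -/
def IsInvariantForm [MulAction SO3 M] (α : ∀ p : M, TangentSpace (𝓡 n) p →L[ℝ] ℝ) : Prop :=
  ∀ (g : SO3) (p : M) (v : TangentSpace (𝓡 n) p),
    α (g • p) (mfderiv (𝓡 n) (𝓡 n) (fun q : M => g • q) p v) = α p v

/-- The moment map `μ : M → so(3)^*`, `⟨μ(p), X⟩ = α_p(X_M(p))`. -/
def momentMap [MulAction SO3 M] [SmoothSO3Action n M]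
    (α : ∀ p : M, TangentSpace (𝓡 n) p →L[ℝ] ℝ) (p : M) : Module.Dual ℝ so3 :=
  (α p).toLinearMap ∘ₗ infGenLinear n M p

end Forms

section Orbits

/-- `H` is a principal stabilizer of the action on `M`: it is the stabilizer of some point, and the
orbit type `SO(3)/H` is the maximum orbit type, i.e. every stabilizer contains a conjugate
of `H`. -/
def IsPrincipalStabilizer (M : Type*) [MulAction SO3 M] (H : Subgroup SO3) : Prop :=
  (∃ p : M, MulAction.stabilizer SO3 p = H) ∧
    ∀ q : M, ∃ g : SO3, H.map (MulAut.conj g).toMonoidHom ≤ MulAction.stabilizer SO3 q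

variable (n : ℕ) {M : Type*} [TopologicalSpace M] [ChartedSpace (EuclideanSpace ℝ (Fin n)) M]
  [MulAction SO3 M] [SmoothSO3Action n M]

/-- The dimension of the orbit through `p`, i.e. of its tangent space `{X_M(p) : X ∈ so(3)}`. -/
def orbitDim (p : M) : ℕ := Module.finrank ℝ (LinearMap.range (infGenLinear n M p))

variable (M) in
/-- The union of the singular orbits of `M`: those whose dimension is smaller than the maximal
dimension of an orbit, which is that of the principal orbits. -/
def singularSet : Set M := {p | ∃ q : M, orbitDim n p < orbitDim n q}

end Orbits

end ContactSO3

end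

/-!
Identify `so(3)` with `ℝ³`, so that the adjoint action becomes the standard action of rotations
(`Ad_hat`) and the moment map becomes an equivariant map `M → ℝ³`.

*Orbits of dimension less than `3` lie in the zero level* (`momentMap_eq_zero_of_orbitDim_ne`). If
`X ≠ 0` generates a one-parameter subgroup fixing `p`, then `μ(p)` is orthogonal to `X`, because
`X_M(p) = 0`, and parallel to `X`, because it is invariant under the rotations `exp(tX)`. So
`μ(p) = 0`.

*Three-dimensional orbits avoid the zero level* (`orbitDim_ne_three_of_momentMap_eq_zero`). On an
orbit in `μ⁻¹(0)` the form `α` vanishes, hence so does `dα`. The tangent space of the orbit is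
therefore isotropic in the symplectic space `ker α` of dimension `4`, and has dimension at most `2`.

*Some orbit is three-dimensional* (`exists_orbitDim_eq_three`). Otherwise `μ` vanishes identically,
and Cartan's formula gives `dα(X_M, ·) = -d(α(X_M)) = 0`. As `X_M` lies in `ker α`, nondegeneracy
forces `X_M = 0` for all `X`, which contradicts effectiveness. These three facts determine the
singular set.

*Principal stabilizers are cyclic* (`finite_isCyclic_of_isPrincipalStabilizer`). The stabilizer of a
point `p` on a three-dimensional orbit has trivial Lie algebra, hence is finite, and it fixes
`μ(p) ≠ 0`. So it is a finite group of rotations about an axis, which embeds into `ℂ` by the angle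
of rotation and is cyclic. A principal stabilizer is conjugate to a subgroup of it.

Cartan's formula and the vanishing of `dα` on orbits both come from
`dForm_infGen_mfderiv_eq_zero`, which pulls `α` back along `(s, t) ↦ exp(sX) c(t)` for a curve `c`.
-/

noncomputable section

namespace ContactSO3

/-! ### The Lie algebra `so(3)` and the cross product -/

section

open Matrix

/-- The isomorphism `ℝ³ ≃ so(3)` carrying `w` to the matrix of `x ↦ w × x`. -/
def hat : (Fin 3 → ℝ) ≃ₗ[ℝ] so3 where
  toFun w := ⟨!![0, -w 2, w 1; w 2, 0, -w 0; -w 1, w 0, 0], by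
    change _ = _
    ext i j
    fin_cases i <;> fin_cases j <;> simp⟩
  map_add' v w := by
    ext i j
    fin_cases i <;> fin_cases j <;> simp <;> ring
  map_smul' c w := by
    ext i j
    fin_cases i <;> fin_cases j <;> simp
  invFun X := ![X.1 2 1, X.1 0 2, X.1 1 0]
  left_inv w := by
    ext i
    fin_cases i <;> simp
  right_inv X := by
    have h : ∀ i j, X.1 j i = -X.1 i j := fun i j => congrFun (congrFun X.2 i) j
    ext i j
    have h0 := h 0 0
    have h1 := h 1 1
    have h2 := h 2 2
    have h3 := h 1 0
    have h4 := h 2 0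
    have h5 := h 2 1
    fin_cases i <;> fin_cases j <;> simp <;> linarith

theorem coe_hat (w : Fin 3 → ℝ) :
    (hat w : Matrix (Fin 3) (Fin 3) ℝ) = !![0, -w 2, w 1; w 2, 0, -w 0; -w 1, w 0, 0] := rfl

instance : FiniteDimensional ℝ so3 := hat.finiteDimensional

theorem finrank_so3 : Module.finrank ℝ so3 = 3 := by
  rw [← hat.finrank_eq]
  simp

theorem SO3_mul_transpose (g : SO3) : (g : Matrix (Fin 3) (Fin 3) ℝ) * g.1ᵀ = 1 :=
  (mem_orthogonalGroup_iff _ _).1 ((mem_specialOrthogonalGroup_iff).1 g.2).1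

theorem SO3_transpose_mul (g : SO3) : g.1ᵀ * (g : Matrix (Fin 3) (Fin 3) ℝ) = 1 :=
  (mem_orthogonalGroup_iff' _ _).1 ((mem_specialOrthogonalGroup_iff).1 g.2).1

theorem SO3_adjugate (g : SO3) : adjugate (g : Matrix (Fin 3) (Fin 3) ℝ) = g.1ᵀ := by
  have hdet : g.1.det = 1 := ((mem_specialOrthogonalGroup_iff).1 g.2).2
  calc adjugate g.1 = adjugate g.1 * (g.1 * g.1ᵀ) := by rw [SO3_mul_transpose, mul_one]
    _ = g.1ᵀ := by rw [← mul_assoc, adjugate_mul, hdet, one_smul, one_mul]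

/-- The adjoint action of `SO(3)` on `so(3)`. -/
def Ad (g : SO3) (X : so3) : so3 :=
  ⟨g.1 * X.1 * g.1ᵀ, by
    have h : X.1ᵀ = -X.1 := X.2
    change (g.1 * X.1 * g.1ᵀ)ᵀ = _
    rw [transpose_mul, transpose_mul, transpose_transpose, h]
    simp [Matrix.mul_assoc]⟩

/-- Under `ℝ³ ≃ so(3)`, the adjoint action is the standard action on `ℝ³`: the entries of a
rotation equal its cofactors. -/
theorem Ad_hat (g : SO3) (w : Fin 3 → ℝ) : Ad g (hat w) = hat (g.1 *ᵥ w) := by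
  have h := SO3_adjugate g
  rw [adjugate_fin_three] at h
  have h' : ∀ i j, _ = g.1ᵀ i j := fun i j => congrFun (congrFun h i) j
  have h00 := h' 0 0
  have h01 := h' 0 1
  have h02 := h' 0 2
  have h10 := h' 1 0
  have h11 := h' 1 1
  have h12 := h' 1 2
  have h20 := h' 2 0
  have h21 := h' 2 1
  have h22 := h' 2 2
  simp at h00 h01 h02 h10 h11 h12 h20 h21 h22
  apply hat.symm.injective
  rw [LinearEquiv.symm_apply_apply]
  change ![(g.1 * (hat w).1 * g.1ᵀ) 2 1, (g.1 * (hat w).1 * g.1ᵀ) 0 2,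
    (g.1 * (hat w).1 * g.1ᵀ) 1 0] = _
  rw [coe_hat]
  ext i
  fin_cases i <;>
    simp [Matrix.mul_apply, Fin.sum_univ_three, Matrix.mulVec, dotProduct]
  · linear_combination w 0 * h00 + w 1 * h10 + w 2 * h20
  · linear_combination w 0 * h01 + w 1 * h11 + w 2 * h21
  · linear_combination w 0 * h02 + w 1 * h12 + w 2 * h22

theorem coe_hat_mulVec (v w : Fin 3 → ℝ) : (hat v).1 *ᵥ w = crossProduct v w := by
  rw [coe_hat, cross_apply]
  ext i
  fin_cases i <;> simp [Matrix.mulVec, dotProduct, Fin.sum_univ_three] <;> ring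

/-- Rotations preserve the cross product. -/
theorem SO3_mulVec_cross (g : SO3) (v w : Fin 3 → ℝ) :
    g.1 *ᵥ crossProduct v w = crossProduct (g.1 *ᵥ v) (g.1 *ᵥ w) := by
  rw [← coe_hat_mulVec, ← coe_hat_mulVec, ← Ad_hat]
  change _ = (g.1 * (hat v).1 * g.1ᵀ) *ᵥ _
  rw [Matrix.mulVec_mulVec, Matrix.mulVec_mulVec, Matrix.mul_assoc _ g.1ᵀ, SO3_transpose_mul,
    Matrix.mul_one]

theorem expSO3_Ad (g : SO3) (X : so3) : expSO3 (Ad g X) = g * expSO3 X * g⁻¹ := by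
  apply Subtype.ext
  have hinv : g.1⁻¹ = g.1ᵀ := Matrix.inv_eq_right_inv (SO3_mul_transpose g)
  have hu : IsUnit g.1 := (Matrix.isUnit_iff_isUnit_det _).2
    (by rw [((mem_specialOrthogonalGroup_iff).1 g.2).2]; exact isUnit_one)
  change NormedSpace.exp (g.1 * X.1 * g.1ᵀ) = g.1 * NormedSpace.exp X.1 * g.1ᵀ
  rw [← hinv, Matrix.exp_conj _ _ hu]

theorem expSO3_add_smul (X : so3) (s t : ℝ) :
    expSO3 ((s + t) • X) = expSO3 (s • X) * expSO3 (t • X) := by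
  apply Subtype.ext
  change NormedSpace.exp ((s + t) • X.1) = NormedSpace.exp (s • X.1) * NormedSpace.exp (t • X.1)
  rw [add_smul, Matrix.exp_add_of_commute]
  exact ((Commute.refl X.1).smul_left s).smul_right t

theorem expSO3_zero : expSO3 0 = 1 := by
  apply Subtype.ext
  change NormedSpace.exp (0 : Matrix (Fin 3) (Fin 3) ℝ) = 1
  simp

theorem Ad_smul (g : SO3) (c : ℝ) (X : so3) : Ad g (c • X) = c • Ad g X := by
  ext1
  simp [Ad]

section
open scoped Matrix.Norms.Operator

theorem contDiff_entries_expSO3 {E : Type*} [NormedAddCommGroup E] [NormedSpace ℝ E]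
    (X : so3) (f : E → ℝ) (hf : ContDiff ℝ ∞ f) :
    ContDiff ℝ ∞ (fun x => entries (expSO3 (f x • X))) := by
  have h1 : ContDiff ℝ ∞ (NormedSpace.exp : Matrix (Fin 3) (Fin 3) ℝ → _) :=
    contDiff_iff_contDiffAt.2 fun A => (NormedSpace.exp_analytic (𝕂 := ℝ) A).contDiffAt
  let L : Matrix (Fin 3) (Fin 3) ℝ →ₗ[ℝ] Mat3 :=
    { toFun := fun A i j => A i j
      map_add' := fun _ _ => rfl
      map_smul' := fun _ _ => rfl }
  exact L.toContinuousLinearMap.contDiff.comp (h1.comp (hf.smul contDiff_const))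

end

theorem entries_injective : Function.Injective entries := Subtype.val_injective

/-- The vector of `ℝ³` representing a linear form on `so(3) ≃ ℝ³` through the dot product. -/
def dualVec (μ : Module.Dual ℝ so3) : Fin 3 → ℝ := fun i => μ (hat (Pi.single i 1))

theorem dualVec_dotProduct (μ : Module.Dual ℝ so3) (w : Fin 3 → ℝ) :
    dualVec μ ⬝ᵥ w = μ (hat w) := by
  have h : w = ∑ i, w i • Pi.single (M := fun _ : Fin 3 => ℝ) i 1 := by
    ext j
    simp [Finset.sum_apply, Pi.single_apply]
  conv_rhs => rw [h]
  simp only [map_sum, map_smul, smul_eq_mul, dotProduct, dualVec]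
  exact Finset.sum_congr rfl fun i _ => mul_comm _ _

theorem dualVec_ne_zero {μ : Module.Dual ℝ so3} (hμ : μ ≠ 0) : dualVec μ ≠ 0 := by
  intro h
  apply hμ
  ext X
  obtain ⟨w, rfl⟩ := hat.surjective X
  rw [← dualVec_dotProduct, h]
  simp

theorem mulVec_dualVec_of_invariant {μ : Module.Dual ℝ so3} {g : SO3}
    (h : ∀ Y, μ (Ad g Y) = μ Y) : g.1 *ᵥ dualVec μ = dualVec μ := by
  have h1 : g.1ᵀ *ᵥ dualVec μ = dualVec μ := by
    refine dotProduct_eq _ _ fun w => ?_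
    rw [Matrix.mulVec_transpose, ← Matrix.dotProduct_mulVec, dualVec_dotProduct,
      dualVec_dotProduct, ← Ad_hat, h]
  conv_lhs => rw [← h1]
  rw [Matrix.mulVec_mulVec, SO3_mul_transpose, Matrix.one_mulVec]

/-- A linear form on `so(3)` invariant under `exp(tX)` for all `t`, with `X ≠ 0`, vanishes as soon
as it vanishes at `X`: as a vector of `ℝ³` it is both parallel and orthogonal to `X`. -/
theorem dual_eq_zero_of_invariant (μ : Module.Dual ℝ so3) (X : so3) (hX : X ≠ 0) (h0 : μ X = 0)
    (hinv : ∀ (t : ℝ) (Y : so3), μ (Ad (expSO3 (t • X)) Y) = μ Y) : μ = 0 := by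
  by_contra hμ
  apply dualVec_ne_zero hμ
  have hfix := fun t => mulVec_dualVec_of_invariant (hinv t)
  set m := dualVec μ
  obtain ⟨v, rfl⟩ := hat.surjective X
  have hv : v ≠ 0 := fun h => hX (by rw [h, map_zero])
  have hcross : crossProduct v m = 0 := by
    rw [← coe_hat_mulVec]
    ext i
    have hd := hasDerivAt_entries_expSO3 (hat v)
    have hd' : HasDerivAt (fun t : ℝ => ∑ j, entries (expSO3 (t • hat v)) i j * m j)
        (∑ j, (hat v).1 i j * m j) 0 :=
      HasDerivAt.fun_sum fun j _ => (hasDerivAt_pi.1 (hasDerivAt_pi.1 hd i) j).mul_const (m j)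
    have hc : (fun t : ℝ => ∑ j, entries (expSO3 (t • hat v)) i j * m j) = fun _ => m i :=
      funext fun t => congrFun (hfix t) i
    rw [hc] at hd'
    exact hd'.unique (hasDerivAt_const _ _)
  have hdot : m ⬝ᵥ v = 0 := by rw [dualVec_dotProduct, h0]
  -- Lagrange's identity `|v × m|² = |v|² |m|² - (v · m)²`
  have hL := cross_dot_cross v m v m
  rw [hcross, dotProduct_comm v m, hdot] at hL
  have hz : v ⬝ᵥ v * (m ⬝ᵥ m) = 0 := by simpa using hL.symm
  rcases mul_eq_zero.1 hz with h | h
  · exact absurd (dotProduct_self_eq_zero.1 h) hv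
  · exact dotProduct_self_eq_zero.1 h

end

/-! ### Finite groups of rotations about an axis -/

section

open Matrix

theorem SO3_dotProduct_mulVec (g : SO3) (v w : Fin 3 → ℝ) :
    (g.1 *ᵥ v) ⬝ᵥ (g.1 *ᵥ w) = v ⬝ᵥ w := by
  rw [Matrix.dotProduct_mulVec, Matrix.vecMul_mulVec, ← Matrix.dotProduct_mulVec,
    SO3_transpose_mul, Matrix.one_mulVec]

/-- The expansion of `w` in the orthogonal basis `m`, `e`, `m × e` of `ℝ³`. -/
theorem orthogonal_frame_expansion {m e : Fin 3 → ℝ} (hme : m ⬝ᵥ e = 0) (w : Fin 3 → ℝ) :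
    ((m ⬝ᵥ m) * (e ⬝ᵥ e)) • w = (w ⬝ᵥ crossProduct m e) • crossProduct m e +
      ((w ⬝ᵥ m) * (e ⬝ᵥ e)) • m + ((w ⬝ᵥ e) * (m ⬝ᵥ m)) • e := by
  simp only [dotProduct, Fin.sum_univ_three] at hme
  rw [cross_apply]
  ext i
  simp only [Pi.add_apply, Pi.smul_apply, smul_eq_mul, dotProduct, Fin.sum_univ_three]
  fin_cases i <;> simp
  · linear_combination ((m 0 * e 0 + m 1 * e 1 + m 2 * e 2) * w 0
      - (w 0 * e 0 + w 1 * e 1 + w 2 * e 2) * m 0 - (w 0 * m 0 + w 1 * m 1 + w 2 * m 2) * e 0) * hme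
  · linear_combination ((m 0 * e 0 + m 1 * e 1 + m 2 * e 2) * w 1
      - (w 0 * e 0 + w 1 * e 1 + w 2 * e 2) * m 1 - (w 0 * m 0 + w 1 * m 1 + w 2 * m 2) * e 1) * hme
  · linear_combination ((m 0 * e 0 + m 1 * e 1 + m 2 * e 2) * w 2
      - (w 0 * e 0 + w 1 * e 1 + w 2 * e 2) * m 2 - (w 0 * m 0 + w 1 * m 1 + w 2 * m 2) * e 2) * hme

theorem exists_orthogonal_ne_zero {m : Fin 3 → ℝ} : ∃ e : Fin 3 → ℝ, e ≠ 0 ∧ m ⬝ᵥ e = 0 := by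
  by_cases h : m 0 = 0
  · exact ⟨![1, 0, 0], fun h0 => by simpa using congrFun h0 0,
      by simp [dotProduct, Fin.sum_univ_three, h]⟩
  · exact ⟨![-m 1, m 0, 0], fun h0 => h (by simpa using congrFun h0 1),
      by simp [dotProduct, Fin.sum_univ_three]; ring⟩

/-- The cosine of the angle of a rotation `g` about the axis `m`, for `e` orthogonal to `m`. -/
def rotCos (e : Fin 3 → ℝ) (g : SO3) : ℝ := (g.1 *ᵥ e) ⬝ᵥ e / (e ⬝ᵥ e)

/-- The sine, divided by the length of `m`, of the angle of a rotation `g` about the axis `m`, for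
`e` orthogonal to `m`. -/
def rotSin (m e : Fin 3 → ℝ) (g : SO3) : ℝ :=
  (g.1 *ᵥ e) ⬝ᵥ crossProduct m e / ((m ⬝ᵥ m) * (e ⬝ᵥ e))

section

variable {m e : Fin 3 → ℝ}

theorem rotation_mulVec (hm : m ≠ 0) (he : e ≠ 0) (hme : m ⬝ᵥ e = 0) {g : SO3}
    (hg : g.1 *ᵥ m = m) :
    g.1 *ᵥ e = rotCos e g • e + rotSin m e g • crossProduct m e := by
  have hN : m ⬝ᵥ m ≠ 0 := fun h => hm (dotProduct_self_eq_zero.1 h)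
  have hE : e ⬝ᵥ e ≠ 0 := fun h => he (dotProduct_self_eq_zero.1 h)
  have h0 : (g.1 *ᵥ e) ⬝ᵥ m = 0 := by
    conv_lhs => rw [← hg]
    rw [SO3_dotProduct_mulVec, dotProduct_comm, hme]
  have h := orthogonal_frame_expansion hme (g.1 *ᵥ e)
  rw [h0] at h
  apply smul_right_injective _ (mul_ne_zero hN hE)
  simp only
  rw [h]
  ext i
  simp [rotCos, rotSin]
  field_simp
  ring

theorem cross_cross_of_orthogonal (hme : m ⬝ᵥ e = 0) :
    crossProduct m (crossProduct m e) = -(m ⬝ᵥ m) • e := by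
  simp only [dotProduct, Fin.sum_univ_three] at hme
  rw [cross_apply, cross_apply]
  ext i
  fin_cases i <;> simp [dotProduct, Fin.sum_univ_three]
  · linear_combination m 0 * hme
  · linear_combination m 1 * hme
  · linear_combination m 2 * hme

theorem rotation_mulVec_cross (hm : m ≠ 0) (he : e ≠ 0) (hme : m ⬝ᵥ e = 0) {g : SO3}
    (hg : g.1 *ᵥ m = m) :
    g.1 *ᵥ crossProduct m e =
      rotCos e g • crossProduct m e - (rotSin m e g * (m ⬝ᵥ m)) • e := by
  rw [SO3_mulVec_cross, hg, rotation_mulVec hm he hme hg, map_add, map_smul, map_smul,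
    cross_cross_of_orthogonal hme, smul_smul]
  ext i
  simp
  ring

/-- The angle of rotation, as a homomorphism into `ℂ`, on a group of rotations about the axis `m`
(for `e` orthogonal to `m`). -/
def rotHom (hm : m ≠ 0) (he : e ≠ 0) (hme : m ⬝ᵥ e = 0) (H : Subgroup SO3)
    (hH : ∀ g ∈ H, g.1 *ᵥ m = m) : H →* ℂ where
  toFun g := ⟨rotCos e g, Real.sqrt (m ⬝ᵥ m) * rotSin m e g⟩
  map_one' := by
    have hE : e ⬝ᵥ e ≠ 0 := fun h => he (dotProduct_self_eq_zero.1 h)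
    apply Complex.ext
    · simp [rotCos, hE]
    · simp [rotSin]
  map_mul' g h := by
    have hN : m ⬝ᵥ m ≠ 0 := fun h => hm (dotProduct_self_eq_zero.1 h)
    have hE : e ⬝ᵥ e ≠ 0 := fun h => he (dotProduct_self_eq_zero.1 h)
    have hs : Real.sqrt (m ⬝ᵥ m) * Real.sqrt (m ⬝ᵥ m) = m ⬝ᵥ m :=
      Real.mul_self_sqrt (by
        simp only [dotProduct]; exact Finset.sum_nonneg fun i _ => mul_self_nonneg _)
    have hmul : (g.1 * h.1).1 *ᵥ e =
        (rotCos e g.1 * rotCos e h.1 - rotSin m e g.1 * rotSin m e h.1 * (m ⬝ᵥ m)) • e +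
        (rotSin m e g.1 * rotCos e h.1 + rotCos e g.1 * rotSin m e h.1) • crossProduct m e := by
      change (g.1.1 * h.1.1) *ᵥ e = _
      rw [← Matrix.mulVec_mulVec, rotation_mulVec hm he hme (hH h.1 h.2), Matrix.mulVec_add,
        Matrix.mulVec_smul, Matrix.mulVec_smul, rotation_mulVec hm he hme (hH g.1 g.2),
        rotation_mulVec_cross hm he hme (hH g.1 g.2)]
      ext i
      simp
      ring
    have hc0 : crossProduct m e ⬝ᵥ e = 0 := by
      rw [dotProduct_comm]; exact dot_cross_self m e
    have hcc : crossProduct m e ⬝ᵥ crossProduct m e = (m ⬝ᵥ m) * (e ⬝ᵥ e) := by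
      rw [cross_dot_cross, hme]; ring
    apply Complex.ext
    · change rotCos e (g.1 * h.1) = rotCos e g.1 * rotCos e h.1 -
        Real.sqrt (m ⬝ᵥ m) * rotSin m e g.1 * (Real.sqrt (m ⬝ᵥ m) * rotSin m e h.1)
      conv_lhs => rw [rotCos, hmul, add_dotProduct, smul_dotProduct, smul_dotProduct, hc0]
      simp only [smul_eq_mul, mul_zero, add_zero]
      rw [mul_div_assoc, div_self hE]
      linear_combination (rotSin m e g.1 * rotSin m e h.1) * hs
    · change Real.sqrt (m ⬝ᵥ m) * rotSin m e (g.1 * h.1) =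
        rotCos e g.1 * (Real.sqrt (m ⬝ᵥ m) * rotSin m e h.1) +
        Real.sqrt (m ⬝ᵥ m) * rotSin m e g.1 * rotCos e h.1
      conv_lhs => rw [rotSin, hmul, add_dotProduct, smul_dotProduct, smul_dotProduct, hcc,
        dotProduct_comm e, hc0]
      simp only [smul_eq_mul, mul_zero, zero_add]
      rw [mul_div_assoc, div_self (mul_ne_zero hN hE)]
      ring

theorem rotHom_injective (hm : m ≠ 0) (he : e ≠ 0) (hme : m ⬝ᵥ e = 0) (H : Subgroup SO3)
    (hH : ∀ g ∈ H, g.1 *ᵥ m = m) : Function.Injective (rotHom hm he hme H hH) := by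
  have hN : m ⬝ᵥ m ≠ 0 := fun h => hm (dotProduct_self_eq_zero.1 h)
  have hE : e ⬝ᵥ e ≠ 0 := fun h => he (dotProduct_self_eq_zero.1 h)
  intro g h hgh
  have hcos : rotCos e g.1 = rotCos e h.1 := congrArg Complex.re hgh
  have hsin : rotSin m e g.1 = rotSin m e h.1 := by
    have hs : Real.sqrt (m ⬝ᵥ m) ≠ 0 := by
      rw [Real.sqrt_ne_zero']
      exact lt_of_le_of_ne
        (by simp only [dotProduct]; exact Finset.sum_nonneg fun i _ => mul_self_nonneg _) hN.symm
    exact mul_left_cancel₀ hs (congrArg Complex.im hgh)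
  have h1 : g.1.1 *ᵥ e = h.1.1 *ᵥ e := by
    rw [rotation_mulVec hm he hme (hH g.1 g.2), rotation_mulVec hm he hme (hH h.1 h.2), hcos, hsin]
  have h2 : g.1.1 *ᵥ m = h.1.1 *ᵥ m := by rw [hH g.1 g.2, hH h.1 h.2]
  have h3 : g.1.1 *ᵥ crossProduct m e = h.1.1 *ᵥ crossProduct m e := by
    rw [SO3_mulVec_cross, SO3_mulVec_cross, h1, h2]
  apply Subtype.ext
  apply Subtype.ext
  apply Matrix.ext_of_mulVec_single
  intro i
  apply smul_right_injective _ (mul_ne_zero hN hE)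
  simp only
  rw [← Matrix.mulVec_smul, ← Matrix.mulVec_smul, orthogonal_frame_expansion hme]
  simp only [Matrix.mulVec_add, Matrix.mulVec_smul, h1, h2, h3]

end

/-- A finite group of rotations about a common axis is cyclic. -/
theorem isCyclic_of_fixes_vector {m : Fin 3 → ℝ} (hm : m ≠ 0) (H : Subgroup SO3) [Finite H]
    (hH : ∀ g ∈ H, g.1 *ᵥ m = m) : IsCyclic H := by
  obtain ⟨e, he, hme⟩ := exists_orthogonal_ne_zero (m := m)
  exact isCyclic_of_injective_ringHom (rotHom hm he hme H hH) (rotHom_injective hm he hme H hH)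

end

/-! ### Exterior derivative of a one-form along a map -/

section

variable {E F : Type*} [NormedAddCommGroup E] [NormedSpace ℝ E]

theorem extDeriv_ofSubsingleton_apply {b : E → E →L[ℝ] ℝ} {z : E} (hb : DifferentiableAt ℝ b z)
    (u v : E) :
    extDeriv (fun y => ContinuousAlternatingMap.ofSubsingleton ℝ E ℝ (0 : Fin 1) (b y)) z ![u, v]
      = fderiv ℝ b z u v - fderiv ℝ b z v u := by
  have hd : DifferentiableAt ℝ
      (fun y => ContinuousAlternatingMap.ofSubsingleton ℝ E ℝ (0 : Fin 1) (b y)) z :=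
    ((ContinuousAlternatingMap.ofSubsingletonLIE (𝕜 := ℝ) (E := E)
      (F := ℝ) (0 : Fin 1)).toContinuousLinearEquiv
      |>.differentiableAt).comp z hb
  have hw : ∀ w : E, fderiv ℝ (fun y => b y w) z = (fderiv ℝ b z).flip w := fun w => by
    rw [fderiv_clm_apply hb (differentiableAt_const w)]
    simp
  rw [extDeriv_apply hd]
  simp [Fin.sum_univ_two, Fin.removeNth, hw, sub_eq_add_neg]

end

theorem contDiffAt_extChartAt_comp {n : ℕ} {M : Type*} [TopologicalSpace M]
    [ChartedSpace (EuclideanSpace ℝ (Fin n)) M]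
    {E' : Type*} [NormedAddCommGroup E'] [NormedSpace ℝ E'] {F : E' → M} {z : E'}
    (hF : ContMDiffAt 𝓘(ℝ, E') (𝓡 n) ∞ F z) :
    ContDiffAt ℝ ∞ (fun x => extChartAt (𝓡 n) (F z) (F x)) z :=
  ((contMDiffAt_extChartAt (I := 𝓡 n) (x := F z)).comp z hF).contDiffAt

section

variable {n : ℕ} {M : Type*} [TopologicalSpace M] [ChartedSpace (EuclideanSpace ℝ (Fin n)) M]
  [IsManifold (𝓡 n) ∞ M] {α : ∀ p : M, TangentSpace (𝓡 n) p →L[ℝ] ℝ}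

theorem differentiableAt_localForm (hα : IsSmoothOneForm α) (p : M) :
    DifferentiableAt ℝ (localForm α p) (extChartAt (𝓡 n) p p) := by
  have : IsManifold (𝓡 n) 1 M := IsManifold.of_le (n := ∞) (by simp)
  have h1 := ((contMDiffAt_hom_bundle _).1 (hα p)).2
  have h2 : ContMDiffAt 𝓘(ℝ, EuclideanSpace ℝ (Fin n)) (𝓡 n) ∞ (extChartAt (𝓡 n) p).symm
      (extChartAt (𝓡 n) p p) :=
    (contMDiffOn_extChartAt_symm p).contMDiffAt (extChartAt_target_mem_nhds p)
  have h3 := ContMDiffAt.comp_of_eq h1 h2 (extChartAt_to_inv p)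
  refine (h3.contDiffAt.differentiableAt (by simp)).congr_of_eventuallyEq ?_
  filter_upwards [extChartAt_target_mem_nhds (I := 𝓡 n) p] with y hy
  have hs : (extChartAt (𝓡 n) p).symm y ∈ (chartAt (EuclideanSpace ℝ (Fin n)) p).source := by
    rw [← extChartAt_source (𝓡 n)]; exact (extChartAt (𝓡 n) p).map_target hy
  simp only [Function.comp_apply, ContinuousLinearMap.inCoordinates, localForm]
  rw [TangentBundle.symmL_trivializationAt hs, (extChartAt (𝓡 n) p).right_inv hy]
  ext v
  simp [mfderivWithin_univ]

section

variable {E' : Type*} [NormedAddCommGroup E'] [NormedSpace ℝ E'] {F : E' → M} {z : E'}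

/-- The local representation of `α` in a chart computes `α` on derivatives of maps into `M`. -/
theorem localForm_fderiv_apply (α : ∀ p : M, TangentSpace (𝓡 n) p →L[ℝ] ℝ) (p : M)
    (hF : MDifferentiableAt 𝓘(ℝ, E') (𝓡 n) F z) (hz : F z ∈ (extChartAt (𝓡 n) p).source) (v : E') :
    localForm α p (extChartAt (𝓡 n) p (F z)) (fderiv ℝ (fun x => extChartAt (𝓡 n) p (F x)) z v) =
      α (F z) (mfderiv 𝓘(ℝ, E') (𝓡 n) F z v) := by
  have : IsManifold (𝓡 n) 1 M := IsManifold.of_le (n := ∞) (by simp)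
  have hz' : F z ∈ (chartAt (EuclideanSpace ℝ (Fin n)) p).source := by
    rwa [← extChartAt_source (𝓡 n)]
  have h1 := (mdifferentiableAt_extChartAt (I := 𝓡 n) hz').hasMFDerivAt
  have h2 := h1.comp z hF.hasMFDerivAt
  have h3 : fderiv ℝ (fun x => extChartAt (𝓡 n) p (F x)) z =
      (mfderiv (𝓡 n) 𝓘(ℝ, EuclideanSpace ℝ (Fin n)) (extChartAt (𝓡 n) p) (F z)).comp
        (mfderiv 𝓘(ℝ, E') (𝓡 n) F z) := by
    rw [← mfderiv_eq_fderiv]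
    exact h2.mfderiv
  have h4 := mfderivWithin_extChartAt_symm_comp_mfderiv_extChartAt' (I := 𝓡 n) hz
  rw [ModelWithCorners.range_eq_univ, mfderivWithin_univ] at h4
  rw [h3, localForm, (extChartAt (𝓡 n) p).left_inv hz]
  exact congrArg (α (F z)) (DFunLike.congr_fun h4 (mfderiv 𝓘(ℝ, E') (𝓡 n) F z v))

theorem eventually_localForm_fderiv_apply (α : ∀ p : M, TangentSpace (𝓡 n) p →L[ℝ] ℝ)
    (hF : ContMDiffAt 𝓘(ℝ, E') (𝓡 n) ∞ F z) :
    ∀ᶠ x in 𝓝 z, ∀ v : E',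
      localForm α (F z) (extChartAt (𝓡 n) (F z) (F x))
        (fderiv ℝ (fun x => extChartAt (𝓡 n) (F z) (F x)) x v) =
      α (F x) (mfderiv 𝓘(ℝ, E') (𝓡 n) F x v) := by
  have : IsManifold (𝓡 n) 1 M := IsManifold.of_le (n := ∞) (by simp)
  have h1 : ∀ᶠ x in 𝓝 z, MDifferentiableAt 𝓘(ℝ, E') (𝓡 n) F x := by
    filter_upwards [(contMDiffAt_iff_contMDiffAt_nhds (n := 1) (by simp)).1
      (hF.of_le (by simp))] with x hx
    exact hx.mdifferentiableAt (by simp)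
  filter_upwards [h1, hF.continuousAt.preimage_mem_nhds (extChartAt_source_mem_nhds (I := 𝓡 n) (F z))]
    with x hx hx' v
  exact localForm_fderiv_apply α (F z) hx hx' v

theorem differentiableAt_pullback (hα : IsSmoothOneForm α)
    (hF : ContMDiffAt 𝓘(ℝ, E') (𝓡 n) ∞ F z) (v : E') :
    DifferentiableAt ℝ (fun x => α (F x) (mfderiv 𝓘(ℝ, E') (𝓡 n) F x v)) z := by
  have hΦ := contDiffAt_extChartAt_comp hF
  have ha := DifferentiableAt.comp z (differentiableAt_localForm hα (F z))
    (hΦ.differentiableAt (by simp))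
  have hd : DifferentiableAt ℝ (fderiv ℝ (fun x => extChartAt (𝓡 n) (F z) (F x))) z :=
    (hΦ.fderiv_right (m := 1) (by norm_cast)).differentiableAt (by simp)
  refine (ha.clm_apply (hd.clm_apply (differentiableAt_const v))).congr_of_eventuallyEq ?_
  filter_upwards [eventually_localForm_fderiv_apply α hF] with x hx
  exact (hx v).symm

/-- The exterior derivative commutes with pullback along a map from a normed space. -/
theorem dForm_mfderiv (hα : IsSmoothOneForm α)
    (hF : ContMDiffAt 𝓘(ℝ, E') (𝓡 n) ∞ F z) (u v : E') :
    dForm α (F z) (mfderiv 𝓘(ℝ, E') (𝓡 n) F z u) (mfderiv 𝓘(ℝ, E') (𝓡 n) F z v) =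
      fderiv ℝ (fun x => α (F x) (mfderiv 𝓘(ℝ, E') (𝓡 n) F x v)) z u -
        fderiv ℝ (fun x => α (F x) (mfderiv 𝓘(ℝ, E') (𝓡 n) F x u)) z v := by
  have : IsManifold (𝓡 n) 1 M := IsManifold.of_le (n := ∞) (by simp)
  set Φ : E' → EuclideanSpace ℝ (Fin n) := fun x => extChartAt (𝓡 n) (F z) (F x) with hΦdef
  have hΦ : ContDiffAt ℝ ∞ Φ z := contDiffAt_extChartAt_comp hF
  have ha := differentiableAt_localForm hα (F z)
  have hd : DifferentiableAt ℝ (fderiv ℝ Φ) z :=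
    (hΦ.fderiv_right (m := 1) (by norm_cast)).differentiableAt (by simp)
  have hb : DifferentiableAt ℝ (fun x => (localForm α (F z) (Φ x)).comp (fderiv ℝ Φ x)) z :=
    (DifferentiableAt.comp z ha (hΦ.differentiableAt (by simp))).clm_comp hd
  have hω := ((ContinuousAlternatingMap.ofSubsingletonLIE (𝕜 := ℝ) (E := EuclideanSpace ℝ (Fin n))
      (F := ℝ) (0 : Fin 1)).toContinuousLinearEquiv.differentiableAt).comp _ ha
  -- near `z`, the pullback of `α` along `F` is the pullback of its local representation along `Φ`
  have hpull := extDeriv_pullback (x := z) (f := Φ) hω hΦ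
    (minSmoothness_of_isRCLikeNormedField.le.trans
      (WithTop.coe_le_coe.2 (le_top : (2 : ℕ∞) ≤ ⊤)))
  have hev : ∀ w : E', fderiv ℝ (fun x => α (F x) (mfderiv 𝓘(ℝ, E') (𝓡 n) F x w)) z =
      (fderiv ℝ (fun x => (localForm α (F z) (Φ x)).comp (fderiv ℝ Φ x)) z).flip w := by
    intro w
    have h1 : (fun x => α (F x) (mfderiv 𝓘(ℝ, E') (𝓡 n) F x w)) =ᶠ[𝓝 z]
        fun x => ((localForm α (F z) (Φ x)).comp (fderiv ℝ Φ x)) w := by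
      filter_upwards [eventually_localForm_fderiv_apply α hF] with x hx
      exact (hx w).symm
    rw [h1.fderiv_eq, fderiv_clm_apply hb (differentiableAt_const w)]
    simp
  have hΦ' : fderiv ℝ Φ z =
      (mfderiv (𝓡 n) 𝓘(ℝ, EuclideanSpace ℝ (Fin n)) (extChartAt (𝓡 n) (F z)) (F z)).comp
        (mfderiv 𝓘(ℝ, E') (𝓡 n) F z) := by
    rw [← mfderiv_eq_fderiv]
    exact ((mdifferentiableAt_extChartAt (I := 𝓡 n) (mem_chart_source _ (F z))).hasMFDerivAt.comp z
      (hF.mdifferentiableAt (by simp)).hasMFDerivAt).mfderiv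
  have hleft := DFunLike.congr_fun hpull ![u, v]
  have hform : (fun x => (((ContinuousAlternatingMap.ofSubsingletonLIE
      (𝕜 := ℝ) (E := EuclideanSpace ℝ (Fin n)) (F := ℝ) (0 : Fin 1)).toContinuousLinearEquiv ∘
        localForm α (F z)) (Φ x)).compContinuousLinearMap (fderiv ℝ Φ x)) =
      fun x => ContinuousAlternatingMap.ofSubsingleton ℝ E' ℝ (0 : Fin 1)
        ((localForm α (F z) (Φ x)).comp (fderiv ℝ Φ x)) := by
    ext x w
    rfl
  rw [hform, extDeriv_ofSubsingleton_apply hb] at hleft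
  rw [hev, hev]
  refine Eq.trans ?_ hleft.symm
  rw [hΦ']
  unfold dForm
  change _ = extDeriv _ _ (_ ∘ ![u, v])
  congr 1
  ext i
  fin_cases i <;> rfl

end

/-- `dα` at a point as a bilinear form. -/
theorem exists_bilin_dForm (hα : IsSmoothOneForm α) (p : M) :
    ∃ B : TangentSpace (𝓡 n) p →ₗ[ℝ] TangentSpace (𝓡 n) p →ₗ[ℝ] ℝ,
      ∀ v w, B v w = dForm α p v w := by
  let L : EuclideanSpace ℝ (Fin n) →L[ℝ] EuclideanSpace ℝ (Fin n) :=
    mfderiv (𝓡 n) 𝓘(ℝ, EuclideanSpace ℝ (Fin n)) (extChartAt (𝓡 n) p) p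
  let D := fderiv ℝ (localForm α p) (extChartAt (𝓡 n) p p)
  let B : EuclideanSpace ℝ (Fin n) →ₗ[ℝ] EuclideanSpace ℝ (Fin n) →ₗ[ℝ] ℝ :=
    LinearMap.mk₂ ℝ (fun v w => D (L v) (L w) - D (L w) (L v))
      (fun v v' w => by simp only [map_add, add_apply]; ring)
      (fun a v w => by simp only [map_smul, smul_apply, smul_eq_mul]; ring)
      (fun v w w' => by simp only [map_add, add_apply]; ring)
      (fun a v w => by simp only [map_smul, smul_apply, smul_eq_mul]; ring)
  exact ⟨B, fun v w =>
    (extDeriv_ofSubsingleton_apply (differentiableAt_localForm hα p) _ _).symm⟩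

end

/-! ### Smoothness of the action and the infinitesimal generators -/

/-- A curve with vanishing derivative is constant. -/
theorem eq_of_mfderiv_eq_zero {n : ℕ} {M : Type*} [TopologicalSpace M]
    [ChartedSpace (EuclideanSpace ℝ (Fin n)) M] [IsManifold (𝓡 n) ∞ M]
    {γ : ℝ → M} (hγ : ContMDiff 𝓘(ℝ, ℝ) (𝓡 n) ∞ γ)
    (h0 : ∀ t, mfderiv 𝓘(ℝ, ℝ) (𝓡 n) γ t = 0) (s t : ℝ) : γ s = γ t := by
  have : IsManifold (𝓡 n) 1 M := IsManifold.of_le (n := ∞) (by simp)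
  refine IsLocallyConstant.apply_eq_of_preconnectedSpace
    ((IsLocallyConstant.iff_eventually_eq γ).2 fun t₀ => ?_) s t
  have hnhds := hγ.continuous.continuousAt.preimage_mem_nhds
    (extChartAt_source_mem_nhds (I := 𝓡 n) (γ t₀))
  obtain ⟨ε, hε, hball⟩ := Metric.mem_nhds_iff.1 hnhds
  have hderiv : ∀ t ∈ Metric.ball t₀ ε, HasFDerivWithinAt (fun u => extChartAt (𝓡 n) (γ t₀) (γ u))
      (0 : ℝ →L[ℝ] EuclideanSpace ℝ (Fin n)) (Metric.ball t₀ ε) t := by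
    intro t ht
    have hs : γ t ∈ (chartAt (EuclideanSpace ℝ (Fin n)) (γ t₀)).source := by
      rw [← extChartAt_source (𝓡 n)]; exact hball ht
    have h1 := (mdifferentiableAt_extChartAt (I := 𝓡 n) hs).hasMFDerivAt.comp t
      (hγ.mdifferentiableAt (by simp) (x := t)).hasMFDerivAt
    rw [h0 t] at h1
    have h2 := (hasMFDerivAt_iff_hasFDerivAt.1 h1).hasFDerivWithinAt (s := Metric.ball t₀ ε)
    refine h2.congr_fderiv ?_
    exact ContinuousLinearMap.comp_zero _
  filter_upwards [Metric.ball_mem_nhds t₀ hε] with t ht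
  have hc := (convex_ball t₀ ε).is_const_of_fderivWithin_eq_zero (𝕜 := ℝ)
    (fun t ht => (hderiv t ht).differentiableWithinAt)
    (fun t ht => (hderiv t ht).fderivWithin (Metric.isOpen_ball.uniqueDiffWithinAt ht))
    ht (Metric.mem_ball_self hε)
  exact (extChartAt (𝓡 n) (γ t₀)).injOn (hball ht) (mem_extChartAt_source (γ t₀)) hc

theorem exp_zero_smul {M : Type*} [MulAction SO3 M] (X : so3) (p : M) :
    expSO3 ((0 : ℝ) • X) • p = p := by
  rw [zero_smul, expSO3_zero, one_smul]

section

variable {n : ℕ} {M : Type*} [TopologicalSpace M] [ChartedSpace (EuclideanSpace ℝ (Fin n)) M]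
  [MulAction SO3 M] [SmoothSO3Action n M]

theorem contMDiffAt_smul {E' H' N : Type*} [NormedAddCommGroup E'] [NormedSpace ℝ E']
    [TopologicalSpace H'] {I : ModelWithCorners ℝ E' H'} [TopologicalSpace N] [ChartedSpace H' N]
    {A : N → SO3} {c : N → M} {x : N} (hA : ContMDiffAt I 𝓘(ℝ, Mat3) ∞ (fun y => entries (A y)) x)
    (hc : ContMDiffAt I (𝓡 n) ∞ c x) : ContMDiffAt I (𝓡 n) ∞ (fun y => A y • c y) x := by
  obtain ⟨U, hU, hmem, F, hF, hFs⟩ := SmoothSO3Action.exists_extension (n := n) (A x) (c x)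
  have hFat := hF.contMDiffAt (hU.mem_nhds hmem)
  have hpair := hA.prodMk hc
  refine (ContMDiffAt.comp x hFat hpair).congr_of_eventuallyEq ?_
  filter_upwards [hpair.continuousAt.preimage_mem_nhds (hU.mem_nhds hmem)] with y hy
  exact (hFs (A y) (c y) hy).symm

variable (n) in
theorem contMDiff_smul (g : SO3) : ContMDiff (𝓡 n) (𝓡 n) ∞ (fun q : M => g • q) :=
  fun _ => contMDiffAt_smul contMDiffAt_const contMDiffAt_id

variable (n) in
theorem mdifferentiableAt_smul (g : SO3) (p : M) :
    MDifferentiableAt (𝓡 n) (𝓡 n) (fun q : M => g • q) p :=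
  (contMDiff_smul n g).mdifferentiableAt (by simp)

variable (n) in
theorem contMDiff_exp_smul (X : so3) (p : M) :
    ContMDiff 𝓘(ℝ, ℝ) (𝓡 n) ∞ (fun t : ℝ => expSO3 (t • X) • p) :=
  fun _ => contMDiffAt_smul (contDiff_entries_expSO3 X id contDiff_id).contMDiff.contMDiffAt
    contMDiffAt_const

variable (n) in
theorem hasMFDerivAt_exp_smul (X : so3) (p : M) :
    HasMFDerivAt 𝓘(ℝ, ℝ) (𝓡 n) (fun t : ℝ => expSO3 (t • X) • p) 0
      (mfderiv 𝓘(ℝ, ℝ) (𝓡 n) (fun t : ℝ => expSO3 (t • X) • p) 0) :=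
  ((contMDiff_exp_smul n X p).mdifferentiableAt (by simp)).hasMFDerivAt

/-- The differential of the action of `g` maps the infinitesimal generator of `X` to that of
`Ad g X`. -/
theorem mfderiv_smul_infGen (g : SO3) (X : so3) (p : M) :
    mfderiv (𝓡 n) (𝓡 n) (fun q : M => g • q) p (infGen n X p) = infGen n (Ad g X) (g • p) := by
  have hg : HasMFDerivAt (𝓡 n) (𝓡 n) (fun q : M => g • q) (expSO3 ((0 : ℝ) • X) • p)
      (mfderiv (𝓡 n) (𝓡 n) (fun q : M => g • q) p) := by
    rw [exp_zero_smul]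
    exact (mdifferentiableAt_smul n g p).hasMFDerivAt
  have h := hg.comp (0 : ℝ) (hasMFDerivAt_exp_smul n X p)
  have heq : (fun q : M => g • q) ∘ (fun t : ℝ => expSO3 (t • X) • p) =
      fun t : ℝ => expSO3 (t • Ad g X) • g • p := by
    funext t
    simp only [Function.comp_apply]
    rw [← Ad_smul, expSO3_Ad, mul_smul, mul_smul, inv_smul_smul]
  rw [heq] at h
  unfold infGen
  rw [h.mfderiv]
  rfl

/-- The one-parameter group of `X` fixes the zeros of the infinitesimal generator of `X`. -/
theorem exp_smul_eq_of_infGen_eq_zero [IsManifold (𝓡 n) ∞ M] {X : so3} {p : M}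
    (h : infGen n X p = 0) (t : ℝ) : expSO3 (t • X) • p = p := by
  refine (eq_of_mfderiv_eq_zero (contMDiff_exp_smul n X p) (fun s => ?_) t 0).trans
    (exp_zero_smul X p)
  set γ : ℝ → M := fun t => expSO3 (t • X) • p
  set σ : ℝ → ℝ := fun t => t - s
  -- translating by `exp(sX)` moves the derivative at `s` to the derivative at `0`, which is `X_M(p)`
  have heq : γ = (fun q : M => expSO3 (s • X) • q) ∘ γ ∘ σ := by
    funext t
    simp only [γ, σ, Function.comp_apply]
    rw [← mul_smul, ← expSO3_add_smul, add_sub_cancel]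
  have hσ : σ s = 0 := sub_self s
  have h1 : HasMFDerivAt 𝓘(ℝ, ℝ) 𝓘(ℝ, ℝ) σ s (ContinuousLinearMap.id ℝ ℝ) :=
    ((hasFDerivAt_id s).sub_const s).hasMFDerivAt
  have h2 : HasMFDerivAt 𝓘(ℝ, ℝ) (𝓡 n) γ (σ s)
      (0 : ℝ →L[ℝ] EuclideanSpace ℝ (Fin n)) := by
    have h0 : mfderiv 𝓘(ℝ, ℝ) (𝓡 n) γ 0 = 0 := by
      ext1
      exact h
    have h3 := hasMFDerivAt_exp_smul n X p
    rw [h0] at h3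
    rw [hσ]
    exact h3
  have h3 := (mdifferentiableAt_smul n (expSO3 (s • X))
    ((γ ∘ σ) s)).hasMFDerivAt.comp s (h2.comp (f := σ) s h1)
  rw [← heq] at h3
  rw [h3.mfderiv]
  ext1
  exact map_zero (mfderiv (𝓡 n) (𝓡 n) (fun q : M => expSO3 (s • X) • q) _)

end

/-! ### Finiteness of stabilizers with trivial Lie algebra -/

section

open Matrix

theorem abs_entries_le_one (g : SO3) (i j : Fin 3) : |entries g i j| ≤ 1 := by
  have h : ∑ k, entries g i k * entries g i k = 1 :=
    (congrFun (congrFun (SO3_mul_transpose g) i) i).trans (Matrix.one_apply_eq i)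
  have h1 : entries g i j * entries g i j ≤ 1 := by
    rw [← h]
    exact Finset.single_le_sum (f := fun k => entries g i k * entries g i k)
      (fun k _ => mul_self_nonneg _) (Finset.mem_univ j)
  exact abs_le_one_iff_mul_self_le_one.2 h1

theorem dist_entries_inv_mul_le (g h : SO3) :
    dist (entries (g⁻¹ * h)) (entries 1) ≤ 3 * dist (entries g) (entries h) := by
  refine (dist_pi_le_iff (by positivity)).2 fun i => (dist_pi_le_iff (by positivity)).2 fun j => ?_
  have h1 : entries (g⁻¹ * h) i j - entries 1 i j =
      ∑ k, entries g k i * (entries h k j - entries g k j) := by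
    have h2 : (1 : SO3) = g⁻¹ * g := (inv_mul_cancel g).symm
    have h3 : ∀ h : SO3, entries (g⁻¹ * h) i j = ∑ k, entries g k i * entries h k j := fun h => rfl
    rw [h2, h3, h3, ← Finset.sum_sub_distrib]
    simp only [mul_sub]
  rw [Real.dist_eq, h1]
  calc |∑ k, entries g k i * (entries h k j - entries g k j)|
      ≤ ∑ k, |entries g k i * (entries h k j - entries g k j)| := Finset.abs_sum_le_sum_abs _ _
    _ ≤ ∑ _k : Fin 3, dist (entries g) (entries h) := by
        refine Finset.sum_le_sum fun k _ => ?_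
        rw [abs_mul]
        have h4 : |entries h k j - entries g k j| ≤ dist (entries g) (entries h) := by
          rw [← Real.dist_eq, dist_comm]
          exact (dist_le_pi_dist (entries g k) (entries h k) j).trans
            (dist_le_pi_dist (entries g) (entries h) k)
        calc _ ≤ 1 * |entries h k j - entries g k j| :=
              mul_le_mul_of_nonneg_right (abs_entries_le_one g k i) (abs_nonneg _)
          _ ≤ _ := by rwa [one_mul]
    _ = 3 * dist (entries g) (entries h) := by simp

/-- A subgroup of `SO(3)` in which the identity is isolated is finite, by compactness. -/
theorem finite_of_isolated_one (H : Subgroup SO3) {ε : ℝ} (hε : 0 < ε)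
    (h : ∀ g ∈ H, dist (entries g) (entries 1) < ε → g = 1) : Finite H := by
  have hsep : ∀ g ∈ H, ∀ g' ∈ H, dist (entries g) (entries g') < ε / 3 → g = g' := by
    intro g hg g' hg' hd
    refine inv_mul_eq_one.1 (h _ (H.mul_mem (H.inv_mem hg) hg') ?_)
    linarith [dist_entries_inv_mul_le g g']
  suffices hfin : (entries '' (H : Set SO3)).Finite from
    (hfin.of_finite_image entries_injective.injOn).to_subtype
  by_contra hinf
  have hsub : entries '' (H : Set SO3) ⊆ Metric.closedBall 0 1 := by
    rintro _ ⟨g, -, rfl⟩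
    rw [mem_closedBall_zero_iff]
    exact (pi_norm_le_iff_of_nonneg zero_le_one).2 fun i =>
      (pi_norm_le_iff_of_nonneg zero_le_one).2 fun j => abs_entries_le_one g i j
  obtain ⟨x, -, hx⟩ := Set.Infinite.exists_accPt_of_subset_isCompact hinf
    (isCompact_closedBall (0 : Mat3) 1) hsub
  rw [accPt_iff_nhds] at hx
  -- two distinct points of the subgroup within `ε / 6` of an accumulation point contradict separation
  obtain ⟨_, ⟨hy, ⟨g, hg, rfl⟩⟩, hyx⟩ := hx _ (Metric.ball_mem_nhds x (show 0 < ε / 6 by positivity))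
  obtain ⟨_, ⟨hz, ⟨g', hg', rfl⟩⟩, hzx⟩ := hx _ (Metric.ball_mem_nhds x
    (lt_min (show 0 < ε / 6 by positivity) (dist_pos.2 hyx)))
  rw [Metric.mem_ball] at hy hz
  have heq : g = g' := by
    refine hsep g hg g' hg' ?_
    have := dist_triangle_right (entries g) (entries g') x
    linarith [hz.trans_le (min_le_left _ _)]
  rw [heq] at hz
  exact lt_irrefl _ (hz.trans_le (min_le_right _ _))

/-- The derivative of `A ↦ A Aᵀ` at the identity is `Z ↦ Z + Zᵀ`. -/
theorem exists_hasFDerivAt_mul_transpose : ∃ Q : Mat3 →L[ℝ] Mat3,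
    HasFDerivAt (fun (A : Mat3) i j => ∑ k, A i k * A j k) Q (entries 1) ∧
      ∀ Z i j, Q Z i j = Z i j + Z j i := by
  have hd : DifferentiableAt ℝ (fun (A : Mat3) i j => ∑ k, A i k * A j k) (entries 1) := by
    fun_prop
  refine ⟨_, hd.hasFDerivAt, fun Z i j => ?_⟩
  have hline : HasDerivAt (fun t : ℝ => entries 1 + t • Z) Z 0 := by
    simpa using ((hasDerivAt_id (0 : ℝ)).smul_const Z).const_add (entries 1)
  have hd' : HasFDerivAt (fun (A : Mat3) i j => ∑ k, A i k * A j k)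
      (fderiv ℝ (fun (A : Mat3) i j => ∑ k, A i k * A j k) (entries 1))
      (entries 1 + (0 : ℝ) • Z) := by
    rw [zero_smul, add_zero]; exact hd.hasFDerivAt
  have h1 := hasDerivAt_pi.1 (hasDerivAt_pi.1 (hd'.comp_hasDerivAt (0 : ℝ) hline) i) j
  have hc : ∀ a b, HasDerivAt (fun t : ℝ => (entries 1 + t • Z) a b) (Z a b) 0 := fun a b =>
    hasDerivAt_pi.1 (hasDerivAt_pi.1 hline a) b
  have h2 : HasDerivAt (fun t : ℝ => ∑ k, (entries 1 + t • Z) i k * (entries 1 + t • Z) j k)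
      _ 0 := HasDerivAt.fun_sum fun k (_ : k ∈ Finset.univ) => (hc i k).mul (hc j k)
  refine (h1.unique h2).trans ?_
  simp [entries, Matrix.one_apply, Finset.sum_add_distrib]

end

section

variable {n : ℕ} {M : Type*} [TopologicalSpace M] [ChartedSpace (EuclideanSpace ℝ (Fin n)) M]
  [IsManifold (𝓡 n) ∞ M] [MulAction SO3 M] [SmoothSO3Action n M]

/-- A stabilizer with trivial Lie algebra is finite: `A ↦ (A p, A Aᵀ)`, defined for matrices `A`
near the identity, has injective derivative there, so the identity is isolated in the stabilizer. -/
theorem finite_stabilizer {p : M} (h : ∀ X : so3, infGen n X p = 0 → X = 0) :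
    Finite (MulAction.stabilizer SO3 p) := by
  have : IsManifold (𝓡 n) 1 M := IsManifold.of_le (n := ∞) (by simp)
  obtain ⟨U, hU, hmem, F, hF, hFs⟩ := SmoothSO3Action.exists_extension (n := n) (1 : SO3) p
  have hF1 : F (entries 1, p) = p := by rw [hFs 1 p hmem, one_smul]
  have hFat : MDifferentiableAt 𝓘(ℝ, Mat3) (𝓡 n) (fun A : Mat3 => F (A, p)) (entries 1) := by
    have hpair : MDifferentiableAt 𝓘(ℝ, Mat3) (𝓘(ℝ, Mat3).prod (𝓡 n))
        (fun A : Mat3 => (A, p)) (entries 1) := mdifferentiableAt_id.prodMk mdifferentiableAt_const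
    exact MDifferentiableAt.comp (entries 1)
      ((hF.contMDiffAt (hU.mem_nhds hmem)).mdifferentiableAt (by simp)) hpair
  set f : Mat3 → EuclideanSpace ℝ (Fin n) := fun A => extChartAt (𝓡 n) p (F (A, p))
  have hφ : HasMFDerivAt (𝓡 n) 𝓘(ℝ, EuclideanSpace ℝ (Fin n)) (extChartAt (𝓡 n) p) p
      (mfderiv (𝓡 n) 𝓘(ℝ, EuclideanSpace ℝ (Fin n)) (extChartAt (𝓡 n) p) p) :=
    (mdifferentiableAt_extChartAt (mem_chart_source _ p)).hasMFDerivAt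
  have hf : DifferentiableAt ℝ f (entries 1) := by
    rw [← mdifferentiableAt_iff_differentiableAt]
    refine MDifferentiableAt.comp (entries 1) ?_ hFat
    rw [hF1]
    exact hφ.mdifferentiableAt
  have hcont : ContinuousAt (fun A : Mat3 => (A, p)) (entries 1) := by fun_prop
  have hUev : ∀ᶠ A in 𝓝 (entries 1), (A, p) ∈ U := hcont.preimage_mem_nhds (hU.mem_nhds hmem)
  -- on `so(3)`, the derivative of `A ↦ A p` is the infinitesimal generator, read in the chart
  have hDX : ∀ X : so3, fderiv ℝ f (entries 1) (fun i j => X.1 i j) =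
      mfderiv (𝓡 n) 𝓘(ℝ, EuclideanSpace ℝ (Fin n)) (extChartAt (𝓡 n) p) p (infGen n X p) := by
    intro X
    have hc := hasDerivAt_entries_expSO3 X
    have hc0 := entries_expSO3_zero_smul X
    have h1 : HasDerivAt (fun t : ℝ => f (entries (expSO3 (t • X))))
        (fderiv ℝ f (entries 1) (fun i j => X.1 i j)) 0 := by
      have hf' : HasFDerivAt f (fderiv ℝ f (entries 1)) (entries (expSO3 ((0 : ℝ) • X))) := by
        rw [hc0]; exact hf.hasFDerivAt
      exact hf'.comp_hasDerivAt (0 : ℝ) hc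
    have hφ' : HasMFDerivAt (𝓡 n) 𝓘(ℝ, EuclideanSpace ℝ (Fin n)) (extChartAt (𝓡 n) p)
        (expSO3 ((0 : ℝ) • X) • p)
        (mfderiv (𝓡 n) 𝓘(ℝ, EuclideanSpace ℝ (Fin n)) (extChartAt (𝓡 n) p) p) := by
      rw [exp_zero_smul]; exact hφ
    let A : EuclideanSpace ℝ (Fin n) →L[ℝ] EuclideanSpace ℝ (Fin n) :=
      mfderiv (𝓡 n) 𝓘(ℝ, EuclideanSpace ℝ (Fin n)) (extChartAt (𝓡 n) p) p
    let B : ℝ →L[ℝ] EuclideanSpace ℝ (Fin n) :=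
      mfderiv 𝓘(ℝ, ℝ) (𝓡 n) (fun t : ℝ => expSO3 (t • X) • p) 0
    have h2 : HasFDerivAt (extChartAt (𝓡 n) p ∘ fun t : ℝ => expSO3 (t • X) • p) (A.comp B) 0 :=
      hasMFDerivAt_iff_hasFDerivAt.1 (hφ'.comp (0 : ℝ) (hasMFDerivAt_exp_smul n X p))
    have hev : ∀ᶠ t : ℝ in 𝓝 0, (entries (expSO3 (t • X)), p) ∈ U :=
      hc.continuousAt.eventually (p := fun A => (A, p) ∈ U) (by
        change ∀ᶠ A in 𝓝 (entries (expSO3 ((0 : ℝ) • X))), (A, p) ∈ U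
        rw [hc0]; exact hUev)
    have heq : (fun t : ℝ => f (entries (expSO3 (t • X)))) =ᶠ[𝓝 0]
        extChartAt (𝓡 n) p ∘ fun t : ℝ => expSO3 (t • X) • p := by
      filter_upwards [hev] with t ht
      simp only [f, Function.comp_apply]
      rw [hFs _ p ht]
    exact h1.unique (h2.hasDerivAt.congr_of_eventuallyEq heq)
  obtain ⟨Q, hQ, hQZ⟩ := exists_hasFDerivAt_mul_transpose
  have hprod := hf.hasFDerivAt.prodMk hQ
  have hker : ((fderiv ℝ f (entries 1)).prod Q).ker = ⊥ := by
    rw [LinearMap.ker_eq_bot']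
    intro Z hZ
    have hZ1 : fderiv ℝ f (entries 1) Z = 0 := congrArg Prod.fst hZ
    have hZ2 : Q Z = 0 := congrArg Prod.snd hZ
    let X : so3 := ⟨Matrix.of Z, by
      change (Matrix.of Z).transpose = -Matrix.of Z
      ext i j
      have := hQZ Z i j
      rw [hZ2] at this
      simp only [Matrix.transpose_apply, Matrix.of_apply, Matrix.neg_apply]
      simp only [Pi.zero_apply] at this
      linarith⟩
    have hX0 : X = 0 := by
      apply h
      have h1 := hDX X
      have h2 := (isInvertible_mfderiv_extChartAt (I := 𝓡 n) (mem_extChartAt_source p)).injective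
      apply h2
      rw [map_zero, ← h1]
      exact hZ1
    ext i j
    exact congrFun (congrFun (congrArg Subtype.val hX0) i) j
  obtain ⟨C, -, hC⟩ := LinearMap.exists_antilipschitzWith _ hker
  have hne := hprod.eventually_ne (c := (f (entries 1), fun i j => ∑ k, entries 1 i k * entries 1 j k))
    ⟨C, hC⟩
  rw [eventually_nhdsWithin_iff] at hne
  obtain ⟨ε, hε, hball⟩ := Metric.eventually_nhds_iff.1 (hne.and hUev)
  refine finite_of_isolated_one _ hε fun g hg hd => ?_
  obtain ⟨h1, h2⟩ := hball hd
  by_contra hg1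
  refine h1 (fun heq => hg1 (entries_injective heq)) (Prod.ext ?_ ?_)
  · simp only [f]
    rw [hFs g p h2, hF1, MulAction.mem_stabilizer_iff.1 hg]
  · have horth : ∀ (g : SO3) i j, ∑ k, entries g i k * entries g j k =
        (1 : Matrix (Fin 3) (Fin 3) ℝ) i j := fun g i j =>
      congrFun (congrFun (SO3_mul_transpose g) i) j
    ext i j
    exact (horth g i j).trans (horth 1 i j).symm

end

/-! ### The moment map of an invariant one-form -/

section

variable {n : ℕ} {M : Type*} [TopologicalSpace M] [ChartedSpace (EuclideanSpace ℝ (Fin n)) M]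
  [MulAction SO3 M] [SmoothSO3Action n M]
  {α : ∀ p : M, TangentSpace (𝓡 n) p →L[ℝ] ℝ}

/-- The moment map is equivariant. -/
theorem momentMap_smul (hinv : IsInvariantForm α) (g : SO3) (p : M) (X : so3) :
    momentMap α (g • p) (Ad g X) = momentMap α p X := by
  change α (g • p) (infGen n (Ad g X) (g • p)) = α p (infGen n X p)
  rw [← mfderiv_smul_infGen, hinv]

theorem momentMap_smul_eq_zero (hinv : IsInvariantForm α) {p : M} (h : momentMap α p = 0)
    (g : SO3) : momentMap α (g • p) = 0 := by
  ext X
  have h1 := momentMap_smul hinv g⁻¹ (g • p) X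
  rw [inv_smul_smul, h] at h1
  rw [← h1]
  rfl

end

section

variable {n : ℕ} {M : Type*} [TopologicalSpace M] [ChartedSpace (EuclideanSpace ℝ (Fin n)) M]
  [IsManifold (𝓡 n) ∞ M] [MulAction SO3 M] [SmoothSO3Action n M]
  {α : ∀ p : M, TangentSpace (𝓡 n) p →L[ℝ] ℝ}

/-- Cartan's formula `dα(X_M, ·) = -d(α(X_M))` for an invariant form, in the case of a curve along
which `α(X_M)` vanishes. It is obtained by pulling `α` back along `(s, t) ↦ exp(sX) c(t)`. -/
theorem dForm_infGen_mfderiv_eq_zero (hα : IsSmoothOneForm α) (hinv : IsInvariantForm α)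
    {c : ℝ → M} (hc : ContMDiffAt 𝓘(ℝ, ℝ) (𝓡 n) ∞ c 0) (X : so3)
    (h0 : ∀ᶠ t in 𝓝 (0 : ℝ), momentMap α (c t) X = 0) :
    dForm α (c 0) (infGen n X (c 0)) (mfderiv 𝓘(ℝ, ℝ) (𝓡 n) c 0 (1 : ℝ)) = 0 := by
  have : IsManifold (𝓡 n) 1 M := IsManifold.of_le (n := ∞) (by simp)
  set F : ℝ × ℝ → M := fun x => expSO3 (x.1 • X) • c x.2 with hFdef
  have hFz : F (0, 0) = c 0 := exp_zero_smul X (c 0)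
  have hF : ContMDiffAt 𝓘(ℝ, ℝ × ℝ) (𝓡 n) ∞ F (0, 0) := by
    refine contMDiffAt_smul ?_ ?_
    · exact (contDiff_entries_expSO3 X Prod.fst contDiff_fst).contMDiff.contMDiffAt
    · have h1 : ContMDiffAt 𝓘(ℝ, ℝ × ℝ) 𝓘(ℝ, ℝ) ∞ (Prod.snd : ℝ × ℝ → ℝ) (0, 0) :=
        contDiff_snd.contMDiff.contMDiffAt
      exact ContMDiffAt.comp (f := (Prod.snd : ℝ × ℝ → ℝ)) (0, 0) hc h1
  have hFev : ∀ᶠ x in 𝓝 ((0, 0) : ℝ × ℝ), MDifferentiableAt 𝓘(ℝ, ℝ × ℝ) (𝓡 n) F x := by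
    filter_upwards [(contMDiffAt_iff_contMDiffAt_nhds (n := 1) (by simp)).1
      (hF.of_le (by simp))] with x hx
    exact hx.mdifferentiableAt (by simp)
  have hl : ∀ s t : ℝ, HasFDerivAt (fun s : ℝ => ((s, t) : ℝ × ℝ))
      (ContinuousLinearMap.inl ℝ ℝ ℝ) s := fun s t => hasFDerivAt_prodMk_left s t
  have hr : ∀ s t : ℝ, HasFDerivAt (fun t : ℝ => ((s, t) : ℝ × ℝ))
      (ContinuousLinearMap.inr ℝ ℝ ℝ) t := fun s t => hasFDerivAt_prodMk_right s t
  -- by invariance, `α(∂F/∂t)` is constant along `t = 0`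
  have hs : ∀ᶠ s in 𝓝 (0 : ℝ), α (F (s, 0)) (mfderiv 𝓘(ℝ, ℝ × ℝ) (𝓡 n) F (s, 0) (0, 1)) =
      α (c 0) (mfderiv 𝓘(ℝ, ℝ) (𝓡 n) c 0 (1 : ℝ)) := by
    filter_upwards [(hl 0 0).continuousAt.eventually hFev] with s hs
    have h1 := hs.hasMFDerivAt.comp (0 : ℝ) (hr s 0).hasMFDerivAt
    have h2 := (mdifferentiableAt_smul n (expSO3 (s • X)) (c 0)).hasMFDerivAt.comp (0 : ℝ)
      (hc.mdifferentiableAt (by simp)).hasMFDerivAt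
    have h3 := DFunLike.congr_fun (hasMFDerivAt_unique h1 h2) (1 : ℝ)
    rw [← hinv (expSO3 (s • X)) (c 0)]
    exact congrArg (α (F (s, 0))) h3
  -- along `s = 0`, `∂F/∂s` is `X_M`, on which `α` vanishes
  have ht : ∀ᶠ t in 𝓝 (0 : ℝ), α (F (0, t)) (mfderiv 𝓘(ℝ, ℝ × ℝ) (𝓡 n) F (0, t) (1, 0)) = 0 := by
    filter_upwards [(hr 0 0).continuousAt.eventually hFev, h0] with t ht ht0
    have h1 := ht.hasMFDerivAt.comp (0 : ℝ) (hl 0 t).hasMFDerivAt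
    have h3 := DFunLike.congr_fun (hasMFDerivAt_unique h1 (hasMFDerivAt_exp_smul n X (c t))) (1 : ℝ)
    have hFt : F (0, t) = c t := exp_zero_smul X (c t)
    have h4 : ∀ q : M, q = c t → α q (infGen n X (c t) : EuclideanSpace ℝ (Fin n)) = 0 := by
      rintro q rfl
      exact ht0
    exact (congrArg (α (F (0, t))) h3).trans (h4 _ hFt)
  -- the exterior derivative of the pullback is the difference of the two derivatives `e1` and `e2`
  have hd := dForm_mfderiv hα hF ((1, 0) : ℝ × ℝ) ((0, 1) : ℝ × ℝ)
  have e1 : fderiv ℝ (fun x => α (F x) (mfderiv 𝓘(ℝ, ℝ × ℝ) (𝓡 n) F x (0, 1))) (0, 0) (1, 0)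
      = 0 := by
    have h1 := ((differentiableAt_pullback hα hF ((0, 1) : ℝ × ℝ)).hasFDerivAt.comp
      (f := fun s : ℝ => ((s, 0) : ℝ × ℝ)) (0 : ℝ) (hl 0 0))
    have h2 : HasFDerivAt ((fun x => α (F x) (mfderiv 𝓘(ℝ, ℝ × ℝ) (𝓡 n) F x (0, 1))) ∘
        fun s : ℝ => ((s, 0) : ℝ × ℝ)) (0 : ℝ →L[ℝ] ℝ) 0 :=
      (hasFDerivAt_const _ _).congr_of_eventuallyEq hs
    exact DFunLike.congr_fun (h1.unique h2) (1 : ℝ)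
  have e2 : fderiv ℝ (fun x => α (F x) (mfderiv 𝓘(ℝ, ℝ × ℝ) (𝓡 n) F x (1, 0))) (0, 0) (0, 1)
      = 0 := by
    have h1 := ((differentiableAt_pullback hα hF ((1, 0) : ℝ × ℝ)).hasFDerivAt.comp
      (f := fun t : ℝ => ((0, t) : ℝ × ℝ)) (0 : ℝ) (hr 0 0))
    have h2 : HasFDerivAt ((fun x => α (F x) (mfderiv 𝓘(ℝ, ℝ × ℝ) (𝓡 n) F x (1, 0))) ∘
        fun t : ℝ => ((0, t) : ℝ × ℝ)) (0 : ℝ →L[ℝ] ℝ) 0 :=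
      (hasFDerivAt_const (0 : ℝ) _).congr_of_eventuallyEq ht
    exact DFunLike.congr_fun (h1.unique h2) (1 : ℝ)
  rw [e1, e2, sub_zero] at hd
  have hzd := (hFev.self_of_nhds).hasMFDerivAt
  have hu := DFunLike.congr_fun (hasMFDerivAt_unique (hzd.comp
    (f := fun s : ℝ => ((s, 0) : ℝ × ℝ)) (0 : ℝ) (hl 0 0).hasMFDerivAt)
    (hasMFDerivAt_exp_smul n X (c 0))) (1 : ℝ)
  have hv : mfderiv 𝓘(ℝ, ℝ × ℝ) (𝓡 n) F (0, 0) (0, 1) =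
      (mfderiv 𝓘(ℝ, ℝ) (𝓡 n) c 0 (1 : ℝ) : EuclideanSpace ℝ (Fin n)) := by
    have h1 := hzd.comp (f := fun t : ℝ => ((0, t) : ℝ × ℝ)) (0 : ℝ) (hr 0 0).hasMFDerivAt
    have h2 : F ∘ (fun t : ℝ => ((0, t) : ℝ × ℝ)) = c := funext fun t => exp_zero_smul X (c t)
    rw [h2] at h1
    exact (DFunLike.congr_fun h1.mfderiv (1 : ℝ)).symm
  -- `F (0, 0)` and `c 0` are equal only propositionally
  have hbase : ∀ q q' : M, q = q' → ∀ u v : EuclideanSpace ℝ (Fin n),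
      dForm α q u v = dForm α q' u v := by
    rintro q _ rfl u v
    rfl
  refine (hbase _ _ hFz.symm _ _).trans (Eq.trans ?_ hd)
  exact (congrArg₂ (dForm α (F (0, 0))) hu hv).symm

end

/-! ### Isotropic orbits and the zero level of the moment map -/

/-- In a hyperplane `ker a` on which the bilinear form `B` is nondegenerate, a subspace isotropic
for `B` has at most half the dimension of the hyperplane. -/
theorem two_mul_finrank_isotropic_le {V : Type*} [AddCommGroup V] [Module ℝ V]
    [FiniteDimensional ℝ V] {a : V →ₗ[ℝ] ℝ} (ha : a ≠ 0) (B : V →ₗ[ℝ] V →ₗ[ℝ] ℝ)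
    (hB : ∀ v, a v = 0 → (∀ w, a w = 0 → B v w = 0) → v = 0) (W : Submodule ℝ V)
    (hW : ∀ v ∈ W, a v = 0) (hiso : ∀ v ∈ W, ∀ w ∈ W, B v w = 0) :
    2 * Module.finrank ℝ W + 1 ≤ Module.finrank ℝ V := by
  set K := LinearMap.ker a
  have hK : Module.finrank ℝ K + 1 = Module.finrank ℝ V := by
    rw [add_comm, ← LinearMap.finrank_range_add_finrank_ker a,
      LinearMap.range_eq_top.2 (LinearMap.surjective ha), finrank_top, Module.finrank_self]
  have hWK : W ≤ K := fun v hv => hW v hv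
  set W' : Submodule ℝ K := W.comap K.subtype
  have hW' : Module.finrank ℝ W' = Module.finrank ℝ W :=
    (Submodule.comapSubtypeEquivOfLe hWK).finrank_eq
  let T : W →ₗ[ℝ] Module.Dual ℝ K :=
    (LinearMap.lcomp ℝ ℝ K.subtype) ∘ₗ B ∘ₗ W.subtype
  have hTapp : ∀ (v : W) (w : K), T v w = B v w := fun v w => rfl
  have hT : Function.Injective T := by
    rw [← LinearMap.ker_eq_bot, LinearMap.ker_eq_bot']
    intro v hv
    ext1
    refine hB v (hW v v.2) fun w hw => ?_
    have := hTapp v ⟨w, hw⟩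
    rw [hv] at this
    exact this.symm
  have hrange : LinearMap.range T ≤ W'.dualAnnihilator := by
    rintro _ ⟨v, rfl⟩
    rw [Submodule.mem_dualAnnihilator]
    intro w hw
    exact hiso v v.2 w hw
  have h1 := Submodule.finrank_mono hrange
  rw [LinearMap.finrank_range_of_inj hT] at h1
  have h2 := Subspace.finrank_add_finrank_dualAnnihilator_eq W'
  omega

section

variable {n : ℕ} {M : Type*} [TopologicalSpace M] [ChartedSpace (EuclideanSpace ℝ (Fin n)) M]
  [MulAction SO3 M] [SmoothSO3Action n M]

theorem orbitDim_le_three (p : M) : orbitDim n p ≤ 3 :=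
  (LinearMap.finrank_range_le _).trans finrank_so3.le

theorem orbitDim_eq_three_iff (p : M) :
    orbitDim n p = 3 ↔ ∀ X : so3, infGen n X p = 0 → X = 0 := by
  have h := LinearMap.finrank_range_add_finrank_ker (infGenLinear n M p)
  rw [finrank_so3] at h
  have h1 : orbitDim n p = 3 ↔ LinearMap.ker (infGenLinear n M p) = ⊥ := by
    rw [← Submodule.finrank_eq_zero, orbitDim]
    omega
  rw [h1, LinearMap.ker_eq_bot']
  rfl

end

section

variable {n : ℕ} {M : Type*} [TopologicalSpace M] [ChartedSpace (EuclideanSpace ℝ (Fin n)) M]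
  [IsManifold (𝓡 n) ∞ M] [MulAction SO3 M] [SmoothSO3Action n M]
  {α : ∀ p : M, TangentSpace (𝓡 n) p →L[ℝ] ℝ}

/-- The moment map vanishes on every orbit of dimension less than `3`: its value at `p` is invariant
under the stabilizer of `p`, and vanishes on the Lie algebra of this stabilizer. -/
theorem momentMap_eq_zero_of_orbitDim_ne (hinv : IsInvariantForm α) {p : M}
    (hp : orbitDim n p ≠ 3) : momentMap α p = 0 := by
  rw [Ne, orbitDim_eq_three_iff] at hp
  push Not at hp
  obtain ⟨X, hX, hX0⟩ := hp
  refine dual_eq_zero_of_invariant (momentMap α p) X hX0 ?_ fun t Y => ?_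
  · change α p (infGen n X p) = 0
    rw [hX, map_zero]
  · have h := momentMap_smul hinv (expSO3 (t • X)) p Y
    rwa [exp_smul_eq_of_infGen_eq_zero hX] at h

theorem dForm_infGen_infGen_eq_zero (hα : IsSmoothOneForm α) (hinv : IsInvariantForm α) {p : M}
    (hp : momentMap α p = 0) (X Y : so3) : dForm α p (infGen n X p) (infGen n Y p) = 0 := by
  have h := dForm_infGen_mfderiv_eq_zero hα hinv
    (contMDiff_exp_smul n Y p).contMDiffAt (c := fun t : ℝ => expSO3 (t • Y) • p) X
    (Eventually.of_forall fun t => by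
      rw [momentMap_smul_eq_zero hinv hp]
      rfl)
  have hbase : ∀ q q' : M, q = q' → ∀ v : EuclideanSpace ℝ (Fin n),
      dForm α q (infGen n X q) v = dForm α q' (infGen n X q') v := by
    rintro q _ rfl v
    rfl
  exact (hbase _ _ (exp_zero_smul Y p) _).symm.trans h

/-- If the moment map vanishes identically, then so do all infinitesimal generators: by Cartan's
formula `dα(X_M, ·) = 0`, and `X_M` is in the contact hyperplane. -/
theorem infGen_eq_zero_of_momentMap_eq_zero (hα : IsContactForm α) (hinv : IsInvariantForm α)
    (h : ∀ p : M, momentMap α p = 0) (X : so3) (p : M) : infGen n X p = 0 := by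
  have : IsManifold (𝓡 n) 1 M := IsManifold.of_le (n := ∞) (by simp)
  refine hα.nondegenerate p _ (by
    change momentMap α p X = 0
    rw [h]
    rfl) fun w _ => ?_
  let L : EuclideanSpace ℝ (Fin n) →L[ℝ] EuclideanSpace ℝ (Fin n) :=
    mfderiv (𝓡 n) 𝓘(ℝ, EuclideanSpace ℝ (Fin n)) (extChartAt (𝓡 n) p) p
  -- the curve that is straight in the chart at `p` and has velocity `w` at `p`
  let w' : EuclideanSpace ℝ (Fin n) := L w
  let ℓ : ℝ → EuclideanSpace ℝ (Fin n) := fun t => extChartAt (𝓡 n) p p + t • w'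
  have hℓ : ContDiff ℝ ∞ ℓ := contDiff_const.add (contDiff_id.smul contDiff_const)
  have hℓ0 : ℓ 0 = extChartAt (𝓡 n) p p := by simp [ℓ]
  have hℓd : HasFDerivAt ℓ (ContinuousLinearMap.smulRight (1 : ℝ →L[ℝ] ℝ) w') 0 := by
    have h1 := ((hasDerivAt_id (0 : ℝ)).smul_const w').const_add (extChartAt (𝓡 n) p p)
    rw [one_smul] at h1
    exact h1.hasFDerivAt
  have hsymm : ContMDiffAt 𝓘(ℝ, EuclideanSpace ℝ (Fin n)) (𝓡 n) ∞ (extChartAt (𝓡 n) p).symm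
      (ℓ 0) := by
    rw [hℓ0]
    exact (contMDiffOn_extChartAt_symm p).contMDiffAt (extChartAt_target_mem_nhds p)
  have hc : ContMDiffAt 𝓘(ℝ, ℝ) (𝓡 n) ∞ ((extChartAt (𝓡 n) p).symm ∘ ℓ) 0 :=
    hsymm.comp (0 : ℝ) hℓ.contMDiff.contMDiffAt
  have hc0 : ((extChartAt (𝓡 n) p).symm ∘ ℓ) 0 = p := by
    simp only [Function.comp_apply]
    rw [hℓ0, extChartAt_to_inv]
  have hcd : mfderiv 𝓘(ℝ, ℝ) (𝓡 n) ((extChartAt (𝓡 n) p).symm ∘ ℓ) 0 (1 : ℝ) =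
      (w : EuclideanSpace ℝ (Fin n)) := by
    have h1 := (hsymm.mdifferentiableAt (by simp)).hasMFDerivAt.comp (0 : ℝ) hℓd.hasMFDerivAt
    have h4 := mfderivWithin_extChartAt_symm_comp_mfderiv_extChartAt' (I := 𝓡 n)
      (mem_extChartAt_source p)
    rw [ModelWithCorners.range_eq_univ, mfderivWithin_univ, ← hℓ0] at h4
    rw [h1.mfderiv]
    refine Eq.trans ?_ (DFunLike.congr_fun h4 w)
    exact congrArg (mfderiv 𝓘(ℝ, EuclideanSpace ℝ (Fin n)) (𝓡 n) (extChartAt (𝓡 n) p).symm (ℓ 0))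
      (one_smul ℝ w')
  have hd := dForm_infGen_mfderiv_eq_zero hα.smooth hinv hc X
    (Eventually.of_forall fun t => by rw [h]; rfl)
  have hbase : ∀ q q' : M, q = q' → ∀ v : EuclideanSpace ℝ (Fin n),
      dForm α q (infGen n X q) v = dForm α q' (infGen n X q') v := by
    rintro q _ rfl v
    rfl
  refine (hbase _ _ hc0.symm _).trans (Eq.trans ?_ hd)
  exact congrArg (dForm α (((extChartAt (𝓡 n) p).symm ∘ ℓ) 0) _) hcd.symm

/-- An effective action preserving a contact form has an orbit of dimension `3`. -/
theorem exists_orbitDim_eq_three [FaithfulSMul SO3 M] (hα : IsContactForm α)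
    (hinv : IsInvariantForm α) : ∃ p : M, orbitDim n p = 3 := by
  by_contra! hne
  have hμ : ∀ p : M, momentMap α p = 0 := fun p => momentMap_eq_zero_of_orbitDim_ne hinv (hne p)
  have hfix : ∀ (X : so3) (p : M) (t : ℝ), expSO3 (t • X) • p = p := fun X p t =>
    exp_smul_eq_of_infGen_eq_zero (infGen_eq_zero_of_momentMap_eq_zero hα hinv hμ X p) t
  have hone : ∀ (X : so3) (t : ℝ), expSO3 (t • X) = 1 := fun X t =>
    FaithfulSMul.eq_of_smul_eq_smul (α := M) fun p => by rw [hfix, one_smul]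
  have hzero : ∀ X : so3, X = 0 := by
    intro X
    have hd := hasDerivAt_entries_expSO3 X
    simp only [hone] at hd
    -- the constant curve `exp(tX) = 1` has derivative `X` at `0`
    have h0 := hd.unique (hasDerivAt_const _ _)
    ext i j
    exact congrFun (congrFun h0 i) j
  have h3 := finrank_so3
  have : Subsingleton so3 := ⟨fun X Y => (hzero X).trans (hzero Y).symm⟩
  rw [Module.finrank_zero_of_subsingleton] at h3
  omega

end

section

variable {M : Type*} [TopologicalSpace M] [ChartedSpace (EuclideanSpace ℝ (Fin 5)) M]
  [IsManifold (𝓡 5) ∞ M] [MulAction SO3 M] [SmoothSO3Action 5 M]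
  {α : ∀ p : M, TangentSpace (𝓡 5) p →L[ℝ] ℝ}

/-- An orbit in the zero level of the moment map is isotropic, hence of dimension at most `2`. -/
theorem orbitDim_ne_three_of_momentMap_eq_zero (hα : IsContactForm α) (hinv : IsInvariantForm α)
    {p : M} (hp : momentMap α p = 0) : orbitDim 5 p ≠ 3 := by
  intro h3
  obtain ⟨B, hB⟩ := exists_bilin_dForm hα.smooth p
  have : FiniteDimensional ℝ (TangentSpace (𝓡 5) p) :=
    inferInstanceAs (FiniteDimensional ℝ (EuclideanSpace ℝ (Fin 5)))
  have h5 : Module.finrank ℝ (TangentSpace (𝓡 5) p) = 5 :=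
    finrank_euclideanSpace_fin (𝕜 := ℝ) (n := 5)
  have h := two_mul_finrank_isotropic_le (a := (α p).toLinearMap)
    (fun h => hα.ne_zero p (ContinuousLinearMap.coe_injective h)) B
    (fun v hv hw => hα.nondegenerate p v hv fun w hw' => (hB v w).symm.trans (hw w hw'))
    (LinearMap.range (infGenLinear 5 M p))
    (by
      rintro _ ⟨X, rfl⟩
      exact DFunLike.congr_fun hp X)
    (by
      rintro _ ⟨X, rfl⟩ _ ⟨Y, rfl⟩
      rw [hB]
      exact dForm_infGen_infGen_eq_zero hα.smooth hinv hp X Y)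
  rw [h5] at h
  change 2 * orbitDim 5 p + 1 ≤ 5 at h
  omega

theorem orbitDim_eq_three_iff_momentMap_ne_zero (hα : IsContactForm α) (hinv : IsInvariantForm α)
    (p : M) : orbitDim 5 p = 3 ↔ momentMap α p ≠ 0 :=
  ⟨fun h h0 => orbitDim_ne_three_of_momentMap_eq_zero hα hinv h0 h,
    fun h => by_contra fun h3 => h (momentMap_eq_zero_of_orbitDim_ne hinv h3)⟩

theorem singularSet_eq [FaithfulSMul SO3 M] (hα : IsContactForm α) (hinv : IsInvariantForm α) :
    singularSet 5 M = {q | momentMap α q = 0} := by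
  obtain ⟨q, hq⟩ := exists_orbitDim_eq_three (M := M) hα hinv
  ext p
  have h := orbitDim_eq_three_iff_momentMap_ne_zero hα hinv p
  constructor
  · rintro ⟨q', hq'⟩
    by_contra h0
    have h1 := h.2 h0
    have h2 := orbitDim_le_three (n := 5) q'
    omega
  · intro h0
    have h1 : orbitDim 5 p ≠ 3 := fun h3 => h.1 h3 h0
    exact ⟨q, by have := orbitDim_le_three (n := 5) p; omega⟩

/-- The stabilizer of a point on a `3`-dimensional orbit is finite and fixes the nonzero value of
the moment map, so it is a finite group of rotations about an axis. -/
theorem finite_isCyclic_stabilizer (hα : IsContactForm α) (hinv : IsInvariantForm α) {p : M}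
    (hp : orbitDim 5 p = 3) :
    Finite (MulAction.stabilizer SO3 p) ∧ IsCyclic (MulAction.stabilizer SO3 p) := by
  have hfin := finite_stabilizer ((orbitDim_eq_three_iff p).1 hp)
  refine ⟨hfin, isCyclic_of_fixes_vector
    (dualVec_ne_zero ((orbitDim_eq_three_iff_momentMap_ne_zero hα hinv p).1 hp)) _ fun g hg =>
      mulVec_dualVec_of_invariant fun Y => ?_⟩
  have h := momentMap_smul hinv g p Y
  rwa [MulAction.mem_stabilizer_iff.1 hg] at h

/-- Principal stabilizers are finite cyclic, being conjugate to subgroups of the stabilizer of a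
point on a `3`-dimensional orbit. -/
theorem finite_isCyclic_of_isPrincipalStabilizer [FaithfulSMul SO3 M] (hα : IsContactForm α)
    (hinv : IsInvariantForm α) {H : Subgroup SO3} (hH : IsPrincipalStabilizer M H) :
    Finite H ∧ IsCyclic H := by
  obtain ⟨p, hp⟩ := exists_orbitDim_eq_three (M := M) hα hinv
  obtain ⟨hfin, hcyc⟩ := finite_isCyclic_stabilizer hα hinv hp
  obtain ⟨g, hg⟩ := hH.2 p
  let f : H →* MulAction.stabilizer SO3 p :=
    (Subgroup.inclusion hg).comp
      (H.equivMapOfInjective _ (MulAut.conj g).injective).toMonoidHom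
  have hf : Function.Injective f :=
    (Subgroup.inclusion_injective hg).comp (MulEquiv.injective _)
  exact ⟨Finite.of_injective f hf, isCyclic_of_injective f hf⟩

end

/-- Principal stabilizers are subconjugate to each other, so finite ones have the same order. -/
theorem card_le_of_isPrincipalStabilizer {M : Type*} [MulAction SO3 M] {H H' : Subgroup SO3}
    (hH : IsPrincipalStabilizer M H) (hH' : IsPrincipalStabilizer M H') [Finite H'] :
    Nat.card H ≤ Nat.card H' := by
  obtain ⟨p, rfl⟩ := hH'.1
  obtain ⟨g, hg⟩ := hH.2 p
  rw [← Subgroup.card_map_of_injective (K := H) (f := (MulAut.conj g).toMonoidHom)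
    (MulAut.conj g).injective]
  exact Subgroup.card_le_of_le hg

end ContactSO3

end


theorem mainTheorem7 {M : Type*} [TopologicalSpace M] [T2Space M] [SecondCountableTopology M]
    [ChartedSpace (EuclideanSpace ℝ (Fin 5)) M] [IsManifold (𝓡 5) ∞ M]
    [MulAction ContactSO3.SO3 M] [ContactSO3.SmoothSO3Action 5 M] [FaithfulSMul ContactSO3.SO3 M]
    (α : ∀ p : M, TangentSpace (𝓡 5) p →L[ℝ] ℝ)
    (hα : ContactSO3.IsContactForm α) (hinv : ContactSO3.IsInvariantForm α) :
    (∃ k : ℕ, 1 ≤ k ∧ ∀ H : Subgroup ContactSO3.SO3, ContactSO3.IsPrincipalStabilizer M H →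
      Nonempty (H ≃* Multiplicative (ZMod k))) ∧
    (∀ p ∈ ContactSO3.singularSet 5 M,
      MulAction.orbit ContactSO3.SO3 p ⊆ {q | ContactSO3.momentMap α q = 0}) ∧
    ContactSO3.singularSet 5 M = {q | ContactSO3.momentMap α q = 0} := by
  refine ⟨?_, ?_, ContactSO3.singularSet_eq hα hinv⟩
  · by_cases hex : ∃ H₀ : Subgroup ContactSO3.SO3, ContactSO3.IsPrincipalStabilizer M H₀
    · obtain ⟨H₀, hH₀⟩ := hex
      obtain ⟨hfin₀, -⟩ := ContactSO3.finite_isCyclic_of_isPrincipalStabilizer hα hinv hH₀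
      refine ⟨Nat.card H₀, Nat.card_pos, fun H hH => ?_⟩
      obtain ⟨hfin, hcyc⟩ := ContactSO3.finite_isCyclic_of_isPrincipalStabilizer hα hinv hH
      rw [(ContactSO3.card_le_of_isPrincipalStabilizer hH₀ hH).antisymm
        (ContactSO3.card_le_of_isPrincipalStabilizer hH hH₀)]
      exact ⟨(zmodCyclicMulEquiv hcyc).symm⟩
    · exact ⟨1, le_rfl, fun H hH => absurd ⟨H, hH⟩ hex⟩
  · rintro p hp _ ⟨g, rfl⟩
    rw [ContactSO3.singularSet_eq hα hinv] at hp
    exact ContactSO3.momentMap_smul_eq_zero hinv hp g
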